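/- Let $n\ge 2$ and let $H^2(\mathbb D^n)$ be the Hardy space of the polydisc, i.e. the Hilbert space of power series $f(z)=\sum_{k\in\mathbb N^n}a_kz^k$ on $\mathbb D^n$ with $\|f\|^2=\sum_k|a_k|^2<\infty$, identified with $H^2(\mathbb D)\otimes\cdots\otimes H^2(\mathbb D)$; let $M_{z_i}$ be multiplication by $z_i$. An invariant subspace is a closed subspace $\mathcal S$ with $M_{z_i}\mathcal S\subseteq\mathcal S$ for all $i$; $\mathcal T(\mathcal S)\subseteq B(\mathcal S)$ denotes the $C^*$-algebra generated by $R_{z_i}=P_{\mathcal S}M_{z_i}|_{\mathcal S}$, $i=1,\dots,n$. Let $\varphi_1,\dots,\varphi_n$ be finite Blaschke products on $\mathbb D$ (unimodular constants allowed). For a bounded analytic function $\theta$ on $\mathbb D$ write $\mathcal S_\theta=\theta H^2(\mathbb D)$ and $\mathcal Q_\theta=H^2(\mathbb D)\ominus\theta H^2(\mathbb D)$, and put $$\mathcal S_\Phi=(\mathcal Q_{\varphi_1}\otimes\cdots\otimes\mathcal Q_{\varphi_n})^\perp .$$ Let $\mathcal S$ be an invariant subspace of finite codimension in $H^2(\mathbb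 D^n)$ with $\mathcal S_\Phi\subseteq\mathcal S$. Then $\mathcal T(\mathcal S)$ and $\mathcal T(\mathcal S_\Phi)$ are unitarily equivalent: there is a unitary $U:\mathcal S\to\mathcal S_\Phi$ with $U\,\mathcal T(\mathcal S)\,U^*=\mathcal T(\mathcal S_\Phi)$. More precisely, $m:=\dim(\mathcal S\ominus\mathcal S_\Phi)$ is finite. Put $$\mathcal F_1=(\varphi_1\mathcal Q_{z^m})\otimes\underbrace{\mathbb C\otimes\cdots\otimes\mathbb C}_{n-1},\qquad \mathcal M_1=(\varphi_1\mathcal Q_{z^m})\otimes\underbrace{\mathbb C\otimes\cdots\otimes\mathbb C}_{n-2}\otimes\, zH^2(\mathbb D),\qquad \mathcal L=\mathcal S_\Phi\ominus(\mathcal F_1\oplus\mathcal M_1),$$ where $\mathbb C$ denotes the constant functions in $H^2(\mathbb D)$. Then $\mathcal F_1$ and $\mathcal M_1$ are mutually orthogonal subspaces of $\mathcal S_\Phi$, so that $\mathcal S_\Phi=\mathcal F_1\oplus\mathcal M_1\oplus\mathcal L$; there is a unitary $\mathcal F_1\to\mathcal S\ominus\mathcal S_\Phi$; and for every such unitary $V$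 there is a unitary $U:\mathcal S_\Phi\to\mathcal S$ with $U|_{\mathcal F_1}=V$, $U|_{\mathcal M_1}=M_{z_n}^*|_{\mathcal M_1}$, $U|_{\mathcal L}=I_{\mathcal L}$, and it satisfies $U\,\mathcal T(\mathcal S_\Phi)\,U^*=\mathcal T(\mathcal S)$. -/

import Mathlib

noncomputable section

/-! ### The Hardy spaces of the disc and of the polydisc

A function in `H²(𝔻ⁿ)` is a power series `∑ a_k z^k` (`k` a multi-index) with square-summable
coefficients; such a series converges at every point of `𝔻ⁿ`.  An element is stored as its family of
Taylor coefficients, and `Hardy.val` is the function on `𝔻ⁿ` that it represents (`Hardy.val_inj`: the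
function determines the element). -/

/-- The Hardy space `H²(𝔻)`: square-summable Taylor coefficients, with the `ℓ²` inner product. -/
abbrev HardyDisc : Type := lp (fun _ : ℕ => ℂ) 2

/-- The Hardy space `H²(𝔻ⁿ)`: square-summable Taylor coefficients, with the `ℓ²` inner product. -/
abbrev Hardy (n : ℕ) : Type := lp (fun _ : Fin n → ℕ => ℂ) 2

/-- The value `f(z) = ∑ a_k z^k` of `f ∈ H²(𝔻)` at `z ∈ 𝔻`. -/
def HardyDisc.val (f : HardyDisc) (z : ℂ) : ℂ := ∑' k : ℕ, f k * z ^ k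

/-- The value `f(z) = ∑ a_k z₁^{k₁} ⋯ zₙ^{kₙ}` of `f ∈ H²(𝔻ⁿ)` at `z ∈ 𝔻ⁿ`. -/
def Hardy.val {n : ℕ} (f : Hardy n) (z : Fin n → ℂ) : ℂ :=
  ∑' k : Fin n → ℕ, f k * ∏ i, z i ^ k i

theorem lpTwo_summable_sq {ι : Type} (f : lp (fun _ : ι => ℂ) 2) :
    Summable fun k => ‖f k‖ ^ 2 := by
  have h := (lp.memℓp f).summable (by norm_num)
  simpa using h

theorem summable_mul_of_sq {ι : Type} {a b : ι → ℂ} (ha : Summable fun k => ‖a k‖ ^ 2)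
    (hb : Summable fun k => ‖b k‖ ^ 2) : Summable fun k => a k * b k := by
  refine Summable.of_norm_bounded (ha.add hb) fun k => ?_
  rw [norm_mul]
  nlinarith [sq_nonneg (‖a k‖ - ‖b k‖), sq_nonneg (‖a k‖), sq_nonneg (‖b k‖)]

theorem summable_prod_pi (n : ℕ) (g : Fin n → ℕ → ℝ) (h0 : ∀ i k, 0 ≤ g i k)
    (hg : ∀ i, Summable (g i)) : Summable fun k : Fin n → ℕ => ∏ i, g i (k i) := by
  induction n with
  | zero => exact Summable.of_finite
  | succ n ih =>
    have h1 := ih (fun i => g i.succ) (fun i k => h0 _ _) (fun i => hg _)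
    have h2 := (hg 0).mul_of_nonneg h1 (h0 0) (fun k => Finset.prod_nonneg fun i _ => h0 _ _)
    refine ((Fin.consEquiv (fun _ : Fin (n + 1) => ℕ)).summable_iff).1 (h2.congr fun p => ?_)
    simp [Fin.prod_univ_succ, Fin.consEquiv]

theorem HardyDisc.summable_val (f : HardyDisc) {z : ℂ} (hz : ‖z‖ < 1) :
    Summable fun k : ℕ => f k * z ^ k := by
  refine summable_mul_of_sq (lpTwo_summable_sq f) ?_
  have h : ‖z‖ ^ 2 < 1 := by nlinarith [norm_nonneg z]
  refine (summable_geometric_of_lt_one (by positivity) h).congr fun k => ?_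
  rw [norm_pow, ← pow_mul, ← pow_mul, mul_comm]

theorem Hardy.summable_val {n : ℕ} (f : Hardy n) {z : Fin n → ℂ} (hz : ∀ i, ‖z i‖ < 1) :
    Summable fun k : Fin n → ℕ => f k * ∏ i, z i ^ k i := by
  refine summable_mul_of_sq (lpTwo_summable_sq f) ?_
  refine (summable_prod_pi n (fun i k => (‖z i‖ ^ 2) ^ k) (fun i k => by positivity)
    fun i => summable_geometric_of_lt_one (by positivity) ?_).congr fun k => ?_
  · nlinarith [norm_nonneg (z i), hz i]
  · rw [norm_prod, ← Finset.prod_pow]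
    refine Finset.prod_congr rfl fun i _ => ?_
    rw [norm_pow, ← pow_mul, ← pow_mul, mul_comm]

theorem HardyDisc.val_add (f g : HardyDisc) {z : ℂ} (hz : ‖z‖ < 1) :
    (f + g).val z = f.val z + g.val z := by
  unfold HardyDisc.val
  rw [← (f.summable_val hz).tsum_add (g.summable_val hz)]
  simp [add_mul]

theorem HardyDisc.val_smul (c : ℂ) (f : HardyDisc) (z : ℂ) : (c • f).val z = c * f.val z := by
  unfold HardyDisc.val
  rw [← tsum_mul_left]
  simp [mul_assoc]

/-- A power series that converges absolutely on the polydisc and vanishes there is zero. -/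
theorem polydisc_coeff_eq_zero (n : ℕ) (a : (Fin n → ℕ) → ℂ)
    (hs : ∀ z : Fin n → ℂ, (∀ i, ‖z i‖ < 1) → Summable fun k => a k * ∏ i, z i ^ k i)
    (h0 : ∀ z : Fin n → ℂ, (∀ i, ‖z i‖ < 1) → ∑' k, a k * ∏ i, z i ^ k i = 0) : a = 0 := by
  induction n with
  | zero =>
    funext k
    have := h0 0 (fun i => i.elim0)
    rw [tsum_eq_single k (fun b hb => (hb (Subsingleton.elim _ _)).elim)] at this
    simpa using this
  | succ n ih =>
    set e := Fin.consEquiv (fun _ : Fin (n + 1) => ℕ) with he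
    have key : ∀ (w : ℂ) (z : Fin n → ℂ), ‖w‖ < 1 → (∀ i, ‖z i‖ < 1) →
        Summable (fun p : ℕ × (Fin n → ℕ) => a (Fin.cons p.1 p.2) * (w ^ p.1 * ∏ i, z i ^ p.2 i)) ∧
        ∑' p : ℕ × (Fin n → ℕ), a (Fin.cons p.1 p.2) * (w ^ p.1 * ∏ i, z i ^ p.2 i) = 0 := by
      intro w z hw hz
      have hz' : ∀ i, ‖(Fin.cons w z : Fin (n + 1) → ℂ) i‖ < 1 := by
        intro i
        refine Fin.cases ?_ (fun j => ?_) i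
        · simpa using hw
        · simpa using hz j
      have h1 := (e.summable_iff).2 (hs _ hz')
      have h2 := (e.tsum_eq (fun k => a k * ∏ i, (Fin.cons w z : Fin (n + 1) → ℂ) i ^ k i)).trans
        (h0 _ hz')
      refine ⟨h1.congr fun p => ?_, ?_⟩
      · simp [he, Fin.consEquiv, Fin.prod_univ_succ]
      · rw [← h2]
        refine tsum_congr fun p => ?_
        simp [he, Fin.consEquiv, Fin.prod_univ_succ]
    have hrow : ∀ (m : ℕ) (z : Fin n → ℂ), (∀ i, ‖z i‖ < 1) →
        Summable fun k : Fin n → ℕ => a (Fin.cons m k) * ∏ i, z i ^ k i := by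
      intro m z hz
      have h := (key (1 / 2) z (by norm_num) hz).1.prod_factor m
      have h' := h.mul_left (((1 / 2 : ℂ) ^ m)⁻¹)
      refine h'.congr fun k => ?_
      have hne : ((1 / 2 : ℂ) ^ m) ≠ 0 := pow_ne_zero _ (by norm_num)
      rw [mul_left_comm (a _), inv_mul_cancel_left₀ hne]
    have hzero : ∀ m : ℕ, (fun k : Fin n → ℕ => a (Fin.cons m k)) = 0 := by
      intro m
      refine ih _ (hrow m) fun z hz => ?_
      set c : ℕ → ℂ := fun m => ∑' k : Fin n → ℕ, a (Fin.cons m k) * ∏ i, z i ^ k i with hc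
      have hsum : ∀ w : ℂ, ‖w‖ < 1 → HasSum (fun m => w ^ m • c m) 0 := by
        intro w hw
        obtain ⟨h1, h2⟩ := key w z hw hz
        have h3 := h1.hasSum.prod_fiberwise (fun m => (h1.prod_factor m).hasSum)
        rw [h2] at h3
        convert h3 using 2 with m
        rw [hc, smul_eq_mul, ← tsum_mul_left]
        exact tsum_congr fun k => by ring
      have hp : HasFPowerSeriesAt (fun _ : ℂ => (0 : ℂ)) (FormalMultilinearSeries.ofScalars ℂ c) 0 := by
        rw [hasFPowerSeriesAt_iff]
        filter_upwards [Metric.ball_mem_nhds (0 : ℂ) one_pos] with w hw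
        have := hsum w (by simpa using hw)
        simpa [FormalMultilinearSeries.coeff_ofScalars] using this
      have h4 : FormalMultilinearSeries.ofScalars ℂ c = 0 := hp.eq_zero
      have h5 : (FormalMultilinearSeries.ofScalars ℂ c).coeff m =
          (0 : FormalMultilinearSeries ℂ ℂ ℂ).coeff m := by rw [h4]
      rw [FormalMultilinearSeries.coeff_ofScalars] at h5
      exact h5
    funext k
    have := congrFun (hzero (k 0)) (Fin.tail k)
    simpa using this

theorem Hardy.val_inj {n : ℕ} {f g : Hardy n}
    (h : ∀ z : Fin n → ℂ, (∀ i, ‖z i‖ < 1) → f.val z = g.val z) : f = g := by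
  rw [← sub_eq_zero]
  have hs := fun (z : Fin n → ℂ) (hz : ∀ i, ‖z i‖ < 1) =>
    (f.summable_val hz).sub (g.summable_val hz)
  have := polydisc_coeff_eq_zero n (fun k => f k - g k)
    (fun z hz => (hs z hz).congr fun k => by ring)
    (fun z hz => by
      have h1 := h z hz
      unfold Hardy.val at h1
      rw [← sub_eq_zero, ← (f.summable_val hz).tsum_sub (g.summable_val hz)] at h1
      rw [← h1]
      exact tsum_congr fun k => by ring)
  ext k
  simpa using congrFun this k

/-! ### Multiplication by the coordinate functions -/

/-- The Taylor coefficients of `z_i f`: the coefficients of `f`, shifted by one in direction `i`. -/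
def shiftCoeff {n : ℕ} (i : Fin n) (a : (Fin n → ℕ) → ℂ) (k : Fin n → ℕ) : ℂ :=
  if k i = 0 then 0 else a (k - Pi.single i 1)

theorem shift_injective {n : ℕ} (i : Fin n) :
    Function.Injective fun k : Fin n → ℕ => k + Pi.single i 1 := fun _ _ h => add_right_cancel h

theorem shiftCoeff_add_single {n : ℕ} (i : Fin n) (a : (Fin n → ℕ) → ℂ) (k : Fin n → ℕ) :
    shiftCoeff i a (k + Pi.single i 1) = a k := by
  simp [shiftCoeff]

theorem shiftCoeff_eq_zero {n : ℕ} (i : Fin n) (a : (Fin n → ℕ) → ℂ) (k : Fin n → ℕ)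
    (hk : k ∉ Set.range fun k : Fin n → ℕ => k + Pi.single i 1) : shiftCoeff i a k = 0 := by
  by_contra h
  have h1 : k i ≠ 0 := fun h0 => h (by simp [shiftCoeff, h0])
  refine hk ⟨k - Pi.single i 1, ?_⟩
  funext j
  by_cases hj : j = i
  · subst hj
    simp
    omega
  · simp [hj]

theorem memℓp_shiftCoeff {n : ℕ} (i : Fin n) (f : Hardy n) : Memℓp (shiftCoeff i f) 2 := by
  refine memℓp_gen ?_
  have h : Summable ((fun k => ‖shiftCoeff i f k‖ ^ (2 : ENNReal).toReal) ∘
      fun k : Fin n → ℕ => k + Pi.single i 1) := by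
    refine (lpTwo_summable_sq f).congr fun k => ?_
    simp [shiftCoeff_add_single]
  refine ((shift_injective i).summable_iff fun k hk => ?_).1 h
  simp [shiftCoeff_eq_zero i f k hk]

/-- The isometry `M_{z_i} f = z_i f` of `H²(𝔻ⁿ)`. -/
def coordMulIsometry (n : ℕ) (i : Fin n) : Hardy n →ₗᵢ[ℂ] Hardy n where
  toFun f := ⟨shiftCoeff i f, memℓp_shiftCoeff i f⟩
  map_add' f g := by
    ext k
    simp only [lp.coeFn_add, Pi.add_apply, shiftCoeff]
    split_ifs <;> simp
  map_smul' c f := by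
    ext k
    simp only [lp.coeFn_smul, Pi.smul_apply, shiftCoeff, RingHom.id_apply]
    split_ifs <;> simp
  norm_map' f := by
    have h2 : (0 : ℝ) < (2 : ENNReal).toReal := by norm_num
    refine (Real.rpow_left_inj (norm_nonneg _) (norm_nonneg _) h2.ne').1 ?_
    rw [lp.norm_rpow_eq_tsum h2, lp.norm_rpow_eq_tsum h2]
    refine ((shift_injective i).tsum_eq ?_).symm.trans (tsum_congr fun k => ?_)
    · intro k hk
      by_contra h
      exact hk (by simp [shiftCoeff_eq_zero i f k h])
    · simp [shiftCoeff_add_single]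

/-- The operator `M_{z_i}` of multiplication by the `i`-th coordinate function on `H²(𝔻ⁿ)`. -/
def coordMul (n : ℕ) (i : Fin n) : Hardy n →L[ℂ] Hardy n :=
  (coordMulIsometry n i).toContinuousLinearMap

theorem coordMul_val {n : ℕ} (i : Fin n) (f : Hardy n) (z : Fin n → ℂ) :
    (coordMul n i f).val z = z i * f.val z := by
  have h : ∀ k : Fin n → ℕ, (coordMul n i f) k = shiftCoeff i f k := fun _ => rfl
  unfold Hardy.val
  rw [← tsum_mul_left]
  refine ((shift_injective i).tsum_eq ?_).symm.trans (tsum_congr fun k => ?_)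
  · intro k hk
    by_contra h'
    exact hk (by simp [h, shiftCoeff_eq_zero i f k h'])
  · simp only [h, shiftCoeff_add_single, Pi.add_apply, pow_add, Finset.prod_mul_distrib]
    have : ∏ j, z j ^ (Pi.single i 1 : Fin n → ℕ) j = z i := by
      rw [Finset.prod_eq_single i (fun j _ hj => by simp [hj]) (by simp)]
      simp
    rw [this]
    ring

/-! ### Tensor products of subspaces of `H²(𝔻)` inside `H²(𝔻ⁿ)` -/

/-- The elementary tensor `f₁ ⊗ ⋯ ⊗ fₙ`, i.e. the function `f₁(z₁) ⋯ fₙ(zₙ)` in `H²(𝔻ⁿ)`. -/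
def hardyTensor {n : ℕ} (f : Fin n → HardyDisc) : Hardy n :=
  ⟨fun k => ∏ i, f i (k i), by
    refine memℓp_gen ?_
    refine (summable_prod_pi n (fun i k => ‖f i k‖ ^ 2) (fun i k => by positivity)
      fun i => lpTwo_summable_sq (f i)).congr fun k => ?_
    simp [norm_prod, Finset.prod_pow]⟩

/-- The Hilbert space tensor product `A₁ ⊗ ⋯ ⊗ Aₙ ⊆ H²(𝔻) ⊗ ⋯ ⊗ H²(𝔻) = H²(𝔻ⁿ)`: the closed linear
span of the elementary tensors with factors in the `A_i`. -/
def tensorSubspace {n : ℕ} (A : Fin n → Submodule ℂ HardyDisc) : Submodule ℂ (Hardy n) :=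
  (Submodule.span ℂ {g | ∃ f : Fin n → HardyDisc, (∀ i, f i ∈ A i) ∧ hardyTensor f = g}).topologicalClosure

/-! ### Finite Blaschke products and the subspaces they define -/

/-- `φ` is, on `𝔻`, a finite Blaschke product `c ∏ (z - a_j) / (1 - \bar{a_j} z)` with `|c| = 1` and
`a_j ∈ 𝔻` (unimodular constants included). -/
def IsFiniteBlaschke (φ : ℂ → ℂ) : Prop :=
  ∃ (c : ℂ) (d : ℕ) (a : Fin d → ℂ), ‖c‖ = 1 ∧ (∀ j, ‖a j‖ < 1) ∧
    ∀ z : ℂ, ‖z‖ < 1 → φ z = c * ∏ j, (z - a j) / (1 - (starRingEnd ℂ) (a j) * z)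

/-- `θ A = {θ f : f ∈ A} ⊆ H²(𝔻)`, for a function `θ` on the disc and a subspace `A` of `H²(𝔻)`. -/
def mulSubspace (θ : ℂ → ℂ) (A : Submodule ℂ HardyDisc) : Submodule ℂ HardyDisc where
  carrier := {g | ∃ f ∈ A, ∀ z : ℂ, ‖z‖ < 1 → g.val z = θ z * f.val z}
  zero_mem' := ⟨0, A.zero_mem, fun z _ => by simp [HardyDisc.val]⟩
  add_mem' := by
    rintro g g' ⟨f, hf, h⟩ ⟨f', hf', h'⟩
    refine ⟨f + f', A.add_mem hf hf', fun z hz => ?_⟩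
    rw [HardyDisc.val_add _ _ hz, HardyDisc.val_add _ _ hz, h z hz, h' z hz]
    ring
  smul_mem' := by
    rintro c g ⟨f, hf, h⟩
    refine ⟨c • f, A.smul_mem c hf, fun z hz => ?_⟩
    rw [HardyDisc.val_smul, HardyDisc.val_smul, h z hz]
    ring

/-- `S_θ = θ H²(𝔻)`. -/
def beurling (θ : ℂ → ℂ) : Submodule ℂ HardyDisc := mulSubspace θ ⊤

/-- `Q_θ = H²(𝔻) ⊖ θ H²(𝔻)`. -/
def modelSpace (θ : ℂ → ℂ) : Submodule ℂ HardyDisc := (beurling θ)ᗮ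

/-- The constant functions in `H²(𝔻)`. -/
def hardyConst : Submodule ℂ HardyDisc where
  carrier := {f | ∃ c : ℂ, ∀ z : ℂ, ‖z‖ < 1 → f.val z = c}
  zero_mem' := ⟨0, fun z _ => by simp [HardyDisc.val]⟩
  add_mem' := by
    rintro f g ⟨c, hc⟩ ⟨d, hd⟩
    exact ⟨c + d, fun z hz => by rw [HardyDisc.val_add _ _ hz, hc z hz, hd z hz]⟩
  smul_mem' := by
    rintro a f ⟨c, hc⟩
    exact ⟨a * c, fun z hz => by rw [HardyDisc.val_smul, hc z hz]⟩

/-- `S_Φ = (Q_{φ₁} ⊗ ⋯ ⊗ Q_{φₙ})^⊥ ⊆ H²(𝔻ⁿ)`. -/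
def coDoublyCommuting {n : ℕ} (φ : Fin n → ℂ → ℂ) : Submodule ℂ (Hardy n) :=
  (tensorSubspace fun i => modelSpace (φ i))ᗮ

instance {n : ℕ} (φ : Fin n → ℂ → ℂ) : CompleteSpace (coDoublyCommuting φ) :=
  inferInstanceAs (CompleteSpace (_ᗮ : Submodule ℂ (Hardy n)))

/-! ### Invariant subspaces and their C*-algebras -/

/-- A closed subspace `S` with `M_{z_i} S ⊆ S` for all `i`. -/
def IsInvariantSubspace {n : ℕ} (S : Submodule ℂ (Hardy n)) : Prop :=
  IsClosed (S : Set (Hardy n)) ∧ ∀ i, ∀ f ∈ S, coordMul n i f ∈ S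

/-- `R_{z_i} = P_S M_{z_i}|_S ∈ B(S)`; for an invariant subspace this is `M_{z_i}|_S`. -/
def restrictedMul {n : ℕ} (S : Submodule ℂ (Hardy n)) [CompleteSpace S] (i : Fin n) : S →L[ℂ] S :=
  S.orthogonalProjectionOnto ∘L coordMul n i ∘L S.subtypeL

/-- The unital C*-algebra of operators on the Hilbert space `H` generated by a set of operators. -/
def operatorCstarAlgebra {H : Type} [NormedAddCommGroup H] [InnerProductSpace ℂ H] [CompleteSpace H]
    (s : Set (H →L[ℂ] H)) : StarSubalgebra ℂ (H →L[ℂ] H) :=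
  (StarAlgebra.adjoin ℂ s).topologicalClosure

/-- `T(S)`: the C*-algebra generated by `R_{z_1}, …, R_{z_n}` in `B(S)`.  (The identity is
`R_{z_1}^* R_{z_1}` when `S` is invariant and `n ≥ 1`, so the unital algebra is the C*-algebra.) -/
def toeplitzAlgebra {n : ℕ} (S : Submodule ℂ (Hardy n)) [CompleteSpace S] :
    StarSubalgebra ℂ (S →L[ℂ] S) :=
  operatorCstarAlgebra (Set.range (restrictedMul S))

/-- The unitary `U : S → S'` satisfies `U T(S) U^* = T(S')`. -/
def Intertwines {n : ℕ} {S S' : Submodule ℂ (Hardy n)} [CompleteSpace S] [CompleteSpace S']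
    (U : S ≃ₗᵢ[ℂ] S') : Prop :=
  (fun T : S →L[ℂ] S => (U : S →L[ℂ] S') ∘L T ∘L (U.symm : S' →L[ℂ] S)) ''
    (toeplitzAlgebra S : Set (S →L[ℂ] S)) = (toeplitzAlgebra S' : Set (S' →L[ℂ] S'))

/-- `T(S)` and `T(S')` are unitarily equivalent. -/
def UnitarilyEquivalentAlgebras {n : ℕ} (S S' : Submodule ℂ (Hardy n)) [CompleteSpace S]
    [CompleteSpace S'] : Prop :=
  ∃ U : S ≃ₗᵢ[ℂ] S', Intertwines U

/-! ### The pieces on which the unitary is prescribed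

Variables are indexed by `Fin n`, so `z₁` and `zₙ` have index values `0` and `n - 1`. -/

/-- `F₁ = (φ₁ Q_{z^m}) ⊗ ℂ ⊗ ⋯ ⊗ ℂ`. -/
def pieceF {n : ℕ} (φ : Fin n → ℂ → ℂ) (m : ℕ) : Submodule ℂ (Hardy n) :=
  tensorSubspace fun i =>
    if (i : ℕ) = 0 then mulSubspace (φ i) (modelSpace fun z => z ^ m) else hardyConst

/-- `M₁ = (φ₁ Q_{z^m}) ⊗ ℂ ⊗ ⋯ ⊗ ℂ ⊗ z H²(𝔻)` (for `n ≥ 2`). -/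
def pieceM {n : ℕ} (φ : Fin n → ℂ → ℂ) (m : ℕ) : Submodule ℂ (Hardy n) :=
  tensorSubspace fun i =>
    if (i : ℕ) = 0 then mulSubspace (φ i) (modelSpace fun z => z ^ m)
    else if (i : ℕ) + 1 = n then beurling fun z => z
    else hardyConst

/-- `L = S_Φ ⊖ (F₁ ⊕ M₁)`. -/
def pieceL {n : ℕ} (φ : Fin n → ℂ → ℂ) (m : ℕ) : Submodule ℂ (Hardy n) :=
  coDoublyCommuting φ ⊓ (pieceF φ m ⊔ pieceM φ m)ᗮ

end

noncomputable section

/-! ### Finite rank operators in irreducible C*-algebras -/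

/-! Let `𝒯` be the C*-algebra generated by the `M_{z_i}` on the whole Hardy space
(`polydiscToeplitz`). For an invariant subspace `S` of finite codimension, `T(S)` is the corner `P_S
𝒯 P_S`: an operator on `S` is in `T(S)` exactly when its extension by zero is in `𝒯`
(`mem_toeplitzAlgebra_iff`). Consequently a unitary between two such subspaces conjugates one
algebra onto the other as soon as its extension by zero lies in `𝒯` (`intertwines_of_mem`).

The corner description rests on the fact that `T(S)` contains every finite rank operator
(`mem_toeplitzAlgebra_of_finiteDimensional_range`). This needs two things. The algebra is
irreducible: an idempotent commuting with the `R_{z_i}` becomes, after multiplication by a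
polynomial in `z_1` carrying the Hardy space into `S`, multiplication by a formal power series, and
formal power series form an integral domain. The algebra also contains a nonzero finite rank
operator: `1 - R_{z_i}^m R_{z_i}^{*m}` is a cutoff of the exponent of `z_i` up to finite rank, and
cutting off in every direction leaves finitely many monomials. An element of minimal positive rank
then has rank one, and irreducibility yields all finite rank operators.

The unitary itself is a Hilbert hotel argument. `M_{z_n}` maps `F₁ ⊕ M₁` isometrically onto `M₁`, so
`M_{z_n}^*` spreads `M₁` over `F₁ ⊕ M₁`; this frees `F₁`, of dimension `m`, to be sent by `V` onto
the missing `S ⊖ S_Φ` (`exists_glued_unitary`). Its extension by zero is a finite rank operator plus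
`M_{z_n}^* P_{M₁} + P_{S_Φ} - P_{F₁} - P_{M₁}`. Only `P_{M₁}` needs an argument: `M₁` is the image
of a coordinate subspace under the isometry `B = φ₁(M_{z_1})`, which is in `𝒯` by a Neumann series,
and `P_{M₁} = B E B^*` with `E` a product of exponent cutoffs. -/

theorem finrank_range_lt_of_eigenvalue {H : Type} [NormedAddCommGroup H] [InnerProductSpace ℂ H]
    (T X : H →L[ℂ] H) [FiniteDimensional ℂ T.range] (hT : T ≠ 0) :
    ∃ c : ℂ, (T * X * T - c • T).range < T.range := by
  have hle : ∀ v ∈ T.range, T (X v) ∈ T.range := fun v _ => ⟨X v, rfl⟩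
  -- On the finite-dimensional range of `T`, `T X` acts as an endomorphism `A`, and `T X T - c T =
  -- (A - c) T`; the constant `c` is an eigenvalue of `A`.
  let A : Module.End ℂ T.range := ((T : H →ₗ[ℂ] H) ∘ₗ (X : H →ₗ[ℂ] H)).restrict hle
  have : Nontrivial T.range := by
    obtain ⟨x, hx⟩ : ∃ x, T x ≠ 0 := by
      by_contra! h
      exact hT (by ext x; simp [h])
    exact ⟨⟨⟨T x, x, rfl⟩, 0, fun h => hx (by simpa using congrArg Subtype.val h)⟩⟩
  obtain ⟨c, hc⟩ := Module.End.exists_eigenvalue A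
  refine ⟨c, lt_of_le_of_ne ?_ fun heq => ?_⟩
  · rintro _ ⟨x, rfl⟩
    refine ⟨X (T x) - c • x, ?_⟩
    simp
  -- If the range did not shrink, `A - c` would be onto, hence injective in finite dimension, and
  -- `c` would have no eigenvector.
  · have hsurj : Function.Surjective (A - c • (1 : Module.End ℂ T.range)) := by
      rintro ⟨y, hy⟩
      rw [← heq] at hy
      obtain ⟨x, rfl⟩ := hy
      refine ⟨⟨T x, x, rfl⟩, Subtype.ext ?_⟩
      simp [A]
    have hinj := LinearMap.injective_iff_surjective.2 hsurj
    obtain ⟨v, hv⟩ := hc.exists_hasEigenvector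
    refine hv.2 (hinj ?_)
    simp [hv.apply_eq_smul]

section FiniteRank

variable {H : Type} [NormedAddCommGroup H] [InnerProductSpace ℂ H] [CompleteSpace H]

/-- For an element `T` of least positive rank, the eigenvalue lemma forces `T X T` to be a scalar
multiple of `T` for every `X` in the algebra; density of the orbit of `T u` then confines the range
of `T` to one line. -/
theorem exists_rankOne_mem {𝒜 : StarSubalgebra ℂ (H →L[ℂ] H)}
    (htr : ∀ e : H, e ≠ 0 → Dense {y | ∃ X ∈ 𝒜, X e = y})
    {T₀ : H →L[ℂ] H} (hT₀ : T₀ ∈ 𝒜) (h0 : T₀ ≠ 0) (hfd : FiniteDimensional ℂ T₀.range) :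
    ∃ a b : H, a ≠ 0 ∧ b ≠ 0 ∧ InnerProductSpace.rankOne ℂ a b ∈ 𝒜 := by
  classical
  have hex : ∃ k : ℕ, ∃ T ∈ 𝒜, T ≠ 0 ∧ FiniteDimensional ℂ T.range ∧ Module.finrank ℂ T.range = k :=
    ⟨_, T₀, hT₀, h0, hfd, rfl⟩
  obtain ⟨T, hT, hne, hTfd, hk⟩ := Nat.find_spec hex
  have hmin : ∀ X ∈ 𝒜, ∃ c : ℂ, T * X * T = c • T := by
    intro X hX
    obtain ⟨c, hc⟩ := finrank_range_lt_of_eigenvalue T X hne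
    refine ⟨c, ?_⟩
    by_contra hcon
    have hlt := Submodule.finrank_lt_finrank_of_lt hc
    rw [hk] at hlt
    refine Nat.find_min hex hlt ⟨T * X * T - c • T, ?_, sub_ne_zero.2 hcon,
      Submodule.finiteDimensional_of_le hc.le, rfl⟩
    exact sub_mem (mul_mem (mul_mem hT hX) hT) (SMulMemClass.smul_mem c hT)
  obtain ⟨u, hu⟩ : ∃ u, T u ≠ 0 := by
    by_contra! h
    exact hne (by ext x; simp [h])
  have hspan : ∀ v, T v ∈ Submodule.span ℂ {T u} := by
    have hcl : IsClosed {v | T v ∈ Submodule.span ℂ {T u}} :=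
      (Submodule.closed_of_finiteDimensional _).preimage T.continuous
    intro v
    refine (htr _ hu).closure_eq ▸ (closure_minimal ?_ hcl : _) <| Set.mem_univ v
    rintro _ ⟨X, hX, rfl⟩
    obtain ⟨c, hc⟩ := hmin X hX
    have := congrArg (fun S : H →L[ℂ] H => S u) hc
    exact Submodule.mem_span_singleton.2 ⟨c, by simpa using this.symm⟩
  have hTu : (inner ℂ (T u) (T u) : ℂ) ≠ 0 := inner_self_ne_zero.2 hu
  -- The coefficient of `T v` along `T u` is `⟨T u, T v⟩ / ⟨T u, T u⟩`, and the adjoint moves `T`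
  -- off `v`.
  have hEq : T = InnerProductSpace.rankOne ℂ (T u)
      ((starRingEnd ℂ (inner ℂ (T u) (T u) : ℂ)⁻¹) • ContinuousLinearMap.adjoint T (T u)) := by
    ext v
    obtain ⟨c, hc⟩ := Submodule.mem_span_singleton.1 (hspan v)
    rw [InnerProductSpace.rankOne_apply, inner_smul_left, ContinuousLinearMap.adjoint_inner_left,
      ← hc, inner_smul_right]
    simp only [RingHomCompTriple.comp_apply, RingHom.id_apply]
    rw [mul_left_comm, inv_mul_cancel₀ hTu, mul_one]
  refine ⟨T u, _, hu, fun hb => hne ?_, hEq ▸ hT⟩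
  rw [hEq, hb]
  simp

/-- A norm-closed star algebra acting transitively up to closure and containing a nonzero operator
of finite rank contains every operator of finite rank. -/
theorem mem_of_finiteDimensional_range {𝒜 : StarSubalgebra ℂ (H →L[ℂ] H)}
    (hcl : IsClosed (𝒜 : Set (H →L[ℂ] H)))
    (htr : ∀ e : H, e ≠ 0 → Dense {y | ∃ X ∈ 𝒜, X e = y})
    {T₀ : H →L[ℂ] H} (hT₀ : T₀ ∈ 𝒜) (h0 : T₀ ≠ 0) (hfd : FiniteDimensional ℂ T₀.range)
    (T : H →L[ℂ] H) (hT : FiniteDimensional ℂ T.range) : T ∈ 𝒜 := by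
  obtain ⟨a, b, ha, hb, hab⟩ := exists_rankOne_mem htr hT₀ h0 hfd
  -- Left multiplication by `X` replaces `a` by `X a`, right multiplication by `Y^*` replaces `b` by
  -- `Y b`; density and closedness give all pairs of vectors.
  have key : ∀ x y : H, InnerProductSpace.rankOne ℂ x y ∈ 𝒜 := by
    have h1 : ∀ x, InnerProductSpace.rankOne ℂ x b ∈ 𝒜 := by
      intro x
      have hc : IsClosed {x : H | InnerProductSpace.rankOne ℂ x b ∈ (𝒜 : Set (H →L[ℂ] H))} :=
        hcl.preimage (by fun_prop)
      refine ((htr _ ha).closure_eq ▸ (closure_minimal ?_ hc : _)) (Set.mem_univ x)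
      rintro _ ⟨X, hX, rfl⟩
      have := mul_mem hX hab
      rwa [show X * InnerProductSpace.rankOne ℂ a b = InnerProductSpace.rankOne ℂ (X a) b by
        ext z; simp] at this
    intro x y
    have hc : IsClosed {y : H | InnerProductSpace.rankOne ℂ x y ∈ (𝒜 : Set (H →L[ℂ] H))} :=
      hcl.preimage (by fun_prop)
    refine ((htr _ hb).closure_eq ▸ (closure_minimal ?_ hc : _)) (Set.mem_univ y)
    rintro _ ⟨Y, hY, rfl⟩
    have := mul_mem (h1 x) (star_mem hY)
    rwa [show InnerProductSpace.rankOne ℂ x b * star Y = InnerProductSpace.rankOne ℂ x (Y b) by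
      ext z
      simp [ContinuousLinearMap.star_eq_adjoint, ContinuousLinearMap.adjoint_inner_right]] at this
  have e := stdOrthonormalBasis ℂ T.range
  have hsum : T = ∑ i, InnerProductSpace.rankOne ℂ (e i : H)
      (ContinuousLinearMap.adjoint T (e i : H)) := by
    ext v
    have := e.sum_repr' ⟨T v, v, rfl⟩
    have h2 := congrArg (Subtype.val) this
    simp only [Submodule.coe_sum, Submodule.coe_smul, Submodule.coe_inner] at h2
    simp only [_root_.sum_apply, InnerProductSpace.rankOne_apply,
      ContinuousLinearMap.adjoint_inner_left]
    exact h2.symm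
  rw [hsum]
  exact sum_mem fun i _ => key _ _

end FiniteRank

/-! ### Finite Blaschke products of an isometry -/

section Blaschke

variable {H : Type} [NormedAddCommGroup H] [InnerProductSpace ℂ H] [CompleteSpace H]

/-- In a closed star algebra, `1 - c M` with `‖c M‖ < 1` has a right inverse. -/
theorem exists_right_inverse_mem {𝒜 : StarSubalgebra ℂ (H →L[ℂ] H)}
    (hcl : IsClosed (𝒜 : Set (H →L[ℂ] H))) {x : H →L[ℂ] H} (hx : x ∈ 𝒜) (hn : ‖x‖ < 1) :
    ∃ w ∈ 𝒜, (1 - x) * w = 1 := by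
  have hs := summable_geometric_of_norm_lt_one hn
  refine ⟨∑' k, x ^ k, ?_, mul_neg_geom_series x hn⟩
  refine hcl.mem_of_tendsto hs.hasSum (Filter.Eventually.of_forall fun s => ?_)
  exact sum_mem fun i _ => pow_mem hx i

/-- The operator is `(M - a)(1 - ā M)⁻¹`. It is isometric because `M^* M = 1` gives `(M - a)^*(M -
a) = (1 - ā M)^*(1 - ā M)`. The evaluation map `ev` is kept abstract so that the disc and the
polydisc are both covered; no continuity of it is needed, since the values of `w f` come from
solving `w f - ā M (w f) = f` pointwise. -/
theorem exists_blaschke_factor {𝒜 : StarSubalgebra ℂ (H →L[ℂ] H)}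
    (hcl : IsClosed (𝒜 : Set (H →L[ℂ] H))) {M : H →L[ℂ] H} (hM : M ∈ 𝒜) (hiso : star M * M = 1)
    {Z : Type} (ev : H →ₗ[ℂ] (Z → ℂ)) (ζ : Z → ℂ) (hζ : ∀ z, ‖ζ z‖ < 1)
    (hev : ∀ f z, ev (M f) z = ζ z * ev f z) {a : ℂ} (ha : ‖a‖ < 1) :
    ∃ B ∈ 𝒜, star B * B = 1 ∧
      ∀ f z, ev (B f) z = (ζ z - a) / (1 - starRingEnd ℂ a * ζ z) * ev f z := by
  have hMn : ‖M‖ ≤ 1 := by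
    have h := CStarRing.norm_star_mul_self (x := M)
    rw [hiso] at h
    have h1 : ‖(1 : H →L[ℂ] H)‖ ≤ 1 := ContinuousLinearMap.norm_id_le
    nlinarith [norm_nonneg M]
  have hn : ‖starRingEnd ℂ a • M‖ < 1 := by
    rw [norm_smul, RCLike.norm_conj]
    nlinarith [norm_nonneg M, norm_nonneg a]
  obtain ⟨w, hw, hw1⟩ :=
    exists_right_inverse_mem hcl (SMulMemClass.smul_mem (starRingEnd ℂ a) hM) hn
  refine ⟨(M - a • 1) * w, mul_mem (sub_mem hM (SMulMemClass.smul_mem a (one_mem _))) hw, ?_, ?_⟩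
  · have h1 : star (M - a • (1 : H →L[ℂ] H)) * (M - a • 1) =
        star (1 - starRingEnd ℂ a • M) * (1 - starRingEnd ℂ a • M) := by
      simp only [star_sub, star_smul, star_one, sub_mul, mul_sub, smul_mul_assoc, mul_smul_comm,
        mul_one, one_mul, hiso, RCLike.star_def, RingHomCompTriple.comp_apply, RingHom.id_apply]
      module
    rw [star_mul, mul_assoc, ← mul_assoc (star (M - _)), h1, mul_assoc, hw1, mul_one, ← star_mul,
      hw1, star_one]
  · intro f z
    have hf : w f - starRingEnd ℂ a • M (w f) = f := by
      simpa using congrArg (fun S : H →L[ℂ] H => S f) hw1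
    have hz := congrFun (congrArg ev hf) z
    simp only [map_sub, map_smul, Pi.sub_apply, Pi.smul_apply, smul_eq_mul, hev] at hz
    have hne : 1 - starRingEnd ℂ a * ζ z ≠ 0 := by
      intro h
      have : ‖starRingEnd ℂ a * ζ z‖ = 1 := by rw [← sub_eq_zero.1 h, norm_one]
      rw [norm_mul, RCLike.norm_conj] at this
      nlinarith [norm_nonneg a, norm_nonneg (ζ z), hζ z]
    rw [div_mul_eq_mul_div, eq_div_iff hne, ← hz]
    simp only [mul_apply_eq_comp, _root_.sub_apply,
      _root_.smul_apply, one_apply_eq_self, map_sub, map_smul,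
      Pi.sub_apply, Pi.smul_apply, smul_eq_mul, hev]
    ring

/-- A finite Blaschke product of an isometry `M` which acts as multiplication by `ζ` is an isometry
which acts as multiplication by `φ ∘ ζ`. -/
theorem exists_blaschke_operator {𝒜 : StarSubalgebra ℂ (H →L[ℂ] H)}
    (hcl : IsClosed (𝒜 : Set (H →L[ℂ] H))) {M : H →L[ℂ] H} (hM : M ∈ 𝒜) (hiso : star M * M = 1)
    {Z : Type} (ev : H →ₗ[ℂ] (Z → ℂ)) (ζ : Z → ℂ) (hζ : ∀ z, ‖ζ z‖ < 1)
    (hev : ∀ f z, ev (M f) z = ζ z * ev f z) {φ : ℂ → ℂ} (hφ : IsFiniteBlaschke φ) :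
    ∃ B ∈ 𝒜, star B * B = 1 ∧ ∀ f z, ev (B f) z = φ (ζ z) * ev f z := by
  obtain ⟨c, d, a, hc, ha, hφ⟩ := hφ
  have key : ∀ (d : ℕ) (a : Fin d → ℂ), (∀ j, ‖a j‖ < 1) → ∃ B ∈ 𝒜, star B * B = 1 ∧
      ∀ f z, ev (B f) z = (∏ j, (ζ z - a j) / (1 - starRingEnd ℂ (a j) * ζ z)) * ev f z := by
    intro d
    induction d with
    | zero => exact fun a _ => ⟨1, one_mem _, by simp, by simp⟩
    | succ d ih =>
      intro a ha
      obtain ⟨B, hB, hB1, hB2⟩ := ih (fun j => a j.succ) fun j => ha _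
      obtain ⟨C, hC, hC1, hC2⟩ := exists_blaschke_factor hcl hM hiso ev ζ hζ hev (ha 0)
      refine ⟨C * B, mul_mem hC hB, ?_, fun f z => ?_⟩
      · rw [star_mul, mul_assoc, ← mul_assoc (star C), hC1, one_mul, hB1]
      · rw [mul_apply_eq_comp, hC2, hB2, Fin.prod_univ_succ, mul_assoc]
  obtain ⟨B, hB, hB1, hB2⟩ := key d a ha
  refine ⟨c • B, SMulMemClass.smul_mem c hB, ?_, fun f z => ?_⟩
  · rw [star_smul, smul_mul_smul_comm, hB1, RCLike.star_def, RCLike.conj_mul, hc]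
    simp
  · rw [hφ _ (hζ z), _root_.smul_apply, map_smul, Pi.smul_apply, hB2, smul_eq_mul,
      mul_assoc]

end Blaschke

/-! ### Coordinates in the Hardy space of the polydisc -/

namespace Hardy

variable {n : ℕ}

/-- The monomial `z^k`. -/
def monomial (k : Fin n → ℕ) : Hardy n := lp.single 2 k (1 : ℂ)

theorem monomial_apply (k l : Fin n → ℕ) : monomial k l = if l = k then 1 else 0 := by
  unfold monomial
  split_ifs with h
  · subst h
    simp
  · exact lp.single_apply_ne 2 k 1 h

theorem inner_monomial (k : Fin n → ℕ) (f : Hardy n) : inner ℂ (monomial k) f = f k := by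
  unfold monomial
  rw [lp.inner_single_left]
  simp

theorem continuous_apply (k : Fin n → ℕ) : Continuous fun f : Hardy n => f k := by
  simp_rw [← inner_monomial]
  fun_prop

/-- The functions whose Taylor coefficients are supported in `A`. -/
def coordSubspace (A : Set (Fin n → ℕ)) : Submodule ℂ (Hardy n) where
  carrier := {f | ∀ k ∉ A, f k = 0}
  zero_mem' := fun k _ => rfl
  add_mem' := fun hf hg k hk => by
    rw [lp.coeFn_add, Pi.add_apply, hf k hk, hg k hk, add_zero]
  smul_mem' := fun c f hf k hk => by
    rw [lp.coeFn_smul, Pi.smul_apply, hf k hk, smul_zero]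

theorem mem_coordSubspace {A : Set (Fin n → ℕ)} {f : Hardy n} :
    f ∈ coordSubspace A ↔ ∀ k ∉ A, f k = 0 := Iff.rfl

theorem monomial_mem_coordSubspace {A : Set (Fin n → ℕ)} {k : Fin n → ℕ} (hk : k ∈ A) :
    monomial k ∈ coordSubspace A := fun l hl => by
  rw [monomial_apply, if_neg]
  rintro rfl
  exact hl hk

theorem isClosed_coordSubspace (A : Set (Fin n → ℕ)) :
    IsClosed (coordSubspace A : Set (Hardy n)) := by
  have : (coordSubspace A : Set (Hardy n)) = ⋂ k ∈ Aᶜ, {f : Hardy n | f k = 0} := by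
    ext f
    simp [mem_coordSubspace]
  rw [this]
  exact isClosed_biInter fun k _ => isClosed_eq (continuous_apply k) continuous_const

theorem coordSubspace_le {A : Set (Fin n → ℕ)} {N : Submodule ℂ (Hardy n)}
    (hN : IsClosed (N : Set (Hardy n))) (h : ∀ k ∈ A, monomial k ∈ N) : coordSubspace A ≤ N := by
  intro f hf
  refine hN.mem_of_tendsto (lp.hasSum_single (by norm_num) f)
    (Filter.Eventually.of_forall fun s => ?_)
  refine N.sum_mem fun k _ => ?_
  by_cases hk : k ∈ A
  · have h1 : lp.single 2 k (f k) = f k • monomial k := by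
      rw [monomial, ← lp.single_smul]
      simp
    rw [h1]
    exact N.smul_mem _ (h k hk)
  · rw [hf k hk, lp.single_zero]
    exact N.zero_mem

theorem mem_of_monomial_mem {N : Submodule ℂ (Hardy n)} (hN : IsClosed (N : Set (Hardy n)))
    (h : ∀ k, monomial k ∈ N) (f : Hardy n) : f ∈ N :=
  coordSubspace_le (A := Set.univ) hN (fun k _ => h k) (fun _ hk => (hk trivial).elim)

/-- On a finite set of exponents, functions are given by their coefficients. -/
def coordSubspaceEquiv (A : Set (Fin n → ℕ)) [Finite A] : coordSubspace A ≃ₗ[ℂ] (A → ℂ) :=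
  LinearEquiv.ofBijective
    { toFun := fun (f : coordSubspace A) (k : A) => (f : Hardy n) (k : Fin n → ℕ)
      map_add' := fun f g => rfl
      map_smul' := fun c f => rfl }
    (by
      classical
      have := Fintype.ofFinite A
      constructor
      · intro f g hfg
        ext k
        by_cases hk : k ∈ A
        · exact congrFun hfg ⟨k, hk⟩
        · rw [f.2 k hk, g.2 k hk]
      · intro c
        refine ⟨∑ k, c k • ⟨monomial k.1, monomial_mem_coordSubspace k.2⟩, ?_⟩
        funext l
        rw [map_sum, Finset.sum_apply]
        simp_rw [map_smul, Pi.smul_apply]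
        refine (Finset.sum_congr rfl fun k _ => ?_).trans (Fintype.sum_ite_eq l c)
        refine (congrArg (c k • ·) (monomial_apply k.1 l.1)).trans ?_
        simp [Subtype.ext_iff])

theorem coordMul_apply (i : Fin n) (f : Hardy n) (k : Fin n → ℕ) :
    coordMul n i f k = if k i = 0 then 0 else f (k - Pi.single i 1) := rfl

theorem coordMul_add_single (i : Fin n) (f : Hardy n) (k : Fin n → ℕ) :
    coordMul n i f (k + Pi.single i 1) = f k := shiftCoeff_add_single i f k

theorem sub_add_single {i : Fin n} {k : Fin n → ℕ} {m : ℕ} (h : m ≤ k i) :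
    k - Pi.single i m + Pi.single i m = k := by
  funext j
  by_cases hj : j = i
  · subst hj
    simp [h]
  · simp [hj]

theorem coordMul_monomial (i : Fin n) (k : Fin n → ℕ) :
    coordMul n i (monomial k) = monomial (k + Pi.single i 1) := by
  ext l
  rw [coordMul_apply, monomial_apply, monomial_apply]
  by_cases h : l i = 0
  · rw [if_pos h, if_neg]
    rintro rfl
    simp at h
  · rw [if_neg h]
    refine if_congr ⟨fun h1 => ?_, fun h1 => ?_⟩ rfl rfl
    · rw [← h1, sub_add_single (Nat.one_le_iff_ne_zero.2 h)]
    · rw [h1, add_tsub_cancel_right]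

theorem adjoint_coordMul_apply (i : Fin n) (f : Hardy n) (k : Fin n → ℕ) :
    ContinuousLinearMap.adjoint (coordMul n i) f k = f (k + Pi.single i 1) := by
  rw [← inner_monomial, ContinuousLinearMap.adjoint_inner_right, coordMul_monomial, inner_monomial]

theorem star_coordMul_apply (i : Fin n) (f : Hardy n) (k : Fin n → ℕ) :
    star (coordMul n i) f k = f (k + Pi.single i 1) := adjoint_coordMul_apply i f k

theorem star_coordMul_mul_self (i : Fin n) : star (coordMul n i) * coordMul n i = 1 := by
  ext f k
  rw [mul_apply_eq_comp, star_coordMul_apply, coordMul_add_single]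
  rfl

theorem coordMul_pow_apply (i : Fin n) (m : ℕ) (f : Hardy n) (k : Fin n → ℕ) :
    (coordMul n i ^ m) f k = if k i < m then 0 else f (k - Pi.single i m) := by
  induction m generalizing k with
  | zero => simp
  | succ m ih =>
    rw [pow_succ', mul_apply_eq_comp, coordMul_apply]
    by_cases h : k i = 0
    · rw [if_pos h, if_pos (by omega)]
    · rw [if_neg h, ih]
      refine if_congr ?_ rfl ?_
      · simp only [Pi.sub_apply, Pi.single_eq_same]
        omega
      · rw [tsub_tsub, ← Pi.single_add, add_comm]

theorem star_coordMul_pow_apply (i : Fin n) (m : ℕ) (f : Hardy n) (k : Fin n → ℕ) :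
    star (coordMul n i ^ m) f k = f (k + Pi.single i m) := by
  induction m generalizing k f with
  | zero => simp
  | succ m ih =>
    rw [pow_succ', star_mul, mul_apply_eq_comp, ih, star_coordMul_apply, add_assoc, ← Pi.single_add]

theorem coordMul_pow_mul_star_apply (i : Fin n) (m : ℕ) (f : Hardy n) (k : Fin n → ℕ) :
    (coordMul n i ^ m * star (coordMul n i ^ m)) f k = if k i < m then 0 else f k := by
  rw [mul_apply_eq_comp, coordMul_pow_apply]
  by_cases h : k i < m
  · rw [if_pos h, if_pos h]
  · rw [if_neg h, if_neg h, star_coordMul_pow_apply, sub_add_single (not_lt.1 h)]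

/-! ### Power series and operators commuting with the coordinate multiplications -/

/-- The formal power series of a function in the Hardy space. -/
def toPowerSeries : Hardy n →ₗ[ℂ] MvPowerSeries (Fin n) ℂ where
  toFun f := fun k => f k
  map_add' _ _ := rfl
  map_smul' _ _ := rfl

theorem coeff_toPowerSeries (f : Hardy n) (k : Fin n →₀ ℕ) :
    MvPowerSeries.coeff k (toPowerSeries f) = f k := rfl

theorem toPowerSeries_injective : Function.Injective (toPowerSeries (n := n)) := by
  intro f g h
  ext k
  have := congrArg (MvPowerSeries.coeff (Finsupp.equivFunOnFinite.symm k)) h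
  simpa [coeff_toPowerSeries] using this

theorem toPowerSeries_monomial_zero : toPowerSeries (monomial (0 : Fin n → ℕ)) = 1 := by
  classical
  ext k
  rw [coeff_toPowerSeries, monomial_apply, MvPowerSeries.coeff_one]
  refine if_congr ?_ rfl rfl
  rw [← Finsupp.coe_zero, DFunLike.coe_fn_eq]

theorem toPowerSeries_coordMul (i : Fin n) (f : Hardy n) :
    toPowerSeries (coordMul n i f) = MvPowerSeries.X i * toPowerSeries f := by
  classical
  ext k
  rw [coeff_toPowerSeries, coordMul_apply, MvPowerSeries.X, MvPowerSeries.coeff_monomial_mul,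
    one_mul,
    coeff_toPowerSeries]
  by_cases h : k i = 0
  · rw [if_pos h, if_neg]
    intro hle
    have := hle i
    simp [h] at this
  · rw [if_neg h, if_pos]
    · have : (k - Finsupp.single i 1 : Fin n →₀ ℕ) =
          (k : Fin n → ℕ) - (Pi.single i 1 : Fin n → ℕ) := by
        funext j
        simp [Finsupp.single_apply, Pi.single_apply, eq_comm]
      rw [this]
    · intro j
      rw [Finsupp.single_apply]
      split_ifs with hj
      · subst hj
        omega
      · exact Nat.zero_le _

/-- An operator commuting with the coordinate multiplications is a multiplication operator. -/
theorem toPowerSeries_apply_of_commute {A : Hardy n →L[ℂ] Hardy n}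
    (hA : ∀ i f, A (coordMul n i f) = coordMul n i (A f)) (f : Hardy n) :
    toPowerSeries (A f) = toPowerSeries (A (monomial 0)) * toPowerSeries f := by
  classical
  set u := toPowerSeries (A (monomial 0)) with hu
  let N : Submodule ℂ (Hardy n) := LinearMap.eqLocus (toPowerSeries ∘ₗ (A : Hardy n →ₗ[ℂ] Hardy n))
    (LinearMap.mulLeft ℂ u ∘ₗ toPowerSeries)
  have hmem : ∀ f, f ∈ N ↔ toPowerSeries (A f) = u * toPowerSeries f := fun f => Iff.rfl
  -- A coefficient of a formal product is a finite sum, so each coefficient of both sides is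
  -- continuous in `f`; nothing has to be known about the growth of `u`.
  have hcl : IsClosed (N : Set (Hardy n)) := by
    have : (N : Set (Hardy n)) = ⋂ k : Fin n →₀ ℕ, {f : Hardy n | A f k =
        ∑ p ∈ Finset.HasAntidiagonal.antidiagonal k, MvPowerSeries.coeff p.1 u * f p.2} := by
      ext f
      simp only [SetLike.mem_coe, hmem, MvPowerSeries.ext_iff, coeff_toPowerSeries,
        MvPowerSeries.coeff_mul, Set.mem_iInter, Set.mem_ofPred_eq]
    rw [this]
    refine isClosed_iInter fun k => isClosed_eq ((continuous_apply _).comp A.continuous) ?_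
    exact continuous_finsetSum _ fun p _ => continuous_const.mul (continuous_apply _)
  refine (hmem f).1 (mem_of_monomial_mem hcl (fun k => ?_) f)
  have hstep : ∀ i f, f ∈ N → coordMul n i f ∈ N := by
    intro i f hf
    rw [hmem] at hf ⊢
    rw [hA, toPowerSeries_coordMul, hf, toPowerSeries_coordMul, mul_left_comm]
  have h0 : monomial 0 ∈ N := by
    rw [hmem, toPowerSeries_monomial_zero, mul_one]
  -- Induction on the total degree of the monomial: each one is a coordinate multiple of a monomial
  -- of degree one less.
  obtain ⟨d, hd⟩ : ∃ d, ∑ i, k i = d := ⟨_, rfl⟩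
  induction d generalizing k with
  | zero =>
    have : k = 0 := funext fun i => (Finset.sum_eq_zero_iff.1 hd) i (Finset.mem_univ i)
    rw [this]
    exact h0
  | succ d ih =>
    obtain ⟨i, -, hi⟩ := Finset.exists_ne_zero_of_sum_ne_zero (hd.trans_ne d.succ_ne_zero)
    have hk := sub_add_single (Nat.one_le_iff_ne_zero.2 hi)
    rw [← hk, ← coordMul_monomial]
    refine hstep _ _ (ih _ ?_)
    have h1 := congrArg (fun l : Fin n → ℕ => ∑ j, l j) hk
    simp only [Pi.add_apply, Finset.sum_add_distrib, Finset.sum_pi_single', Finset.mem_univ,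
      if_true] at h1
    simp only [hd] at h1
    exact Nat.succ.inj h1

end Hardy

/-! ### Invariant subspaces of finite codimension -/

open Hardy

theorem subset_operatorCstarAlgebra {H : Type} [NormedAddCommGroup H] [InnerProductSpace ℂ H]
    [CompleteSpace H] (s : Set (H →L[ℂ] H)) : s ⊆ operatorCstarAlgebra s :=
  (StarAlgebra.subset_adjoin ℂ s).trans (StarSubalgebra.le_topologicalClosure _)

theorem isClosed_operatorCstarAlgebra {H : Type} [NormedAddCommGroup H] [InnerProductSpace ℂ H]
    [CompleteSpace H] (s : Set (H →L[ℂ] H)) :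
    IsClosed (operatorCstarAlgebra s : Set (H →L[ℂ] H)) :=
  StarSubalgebra.isClosed_topologicalClosure _

theorem commute_aeval {A : Type} [Ring A] [Algebra ℂ A] {x y : A} (h : Commute x y)
    (p : Polynomial ℂ) : Commute (Polynomial.aeval x p) y := by
  induction p using Polynomial.induction_on' with
  | add p q hp hq =>
    rw [map_add]
    exact hp.add_left hq
  | monomial k c =>
    rw [Polynomial.aeval_monomial]
    exact (Algebra.commute_algebraMap_left c y).mul_left (h.pow_left k)

section Invariant

variable {n : ℕ} {S : Submodule ℂ (Hardy n)}

theorem coe_restrictedMul [CompleteSpace S] (hS : IsInvariantSubspace S) (i : Fin n) (f : S) :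
    (restrictedMul S i f : Hardy n) = coordMul n i f :=
  Submodule.starProjection_eq_self_iff.2 (hS.2 i f f.2)

theorem coe_restrictedMul_pow [CompleteSpace S] (hS : IsInvariantSubspace S) (i : Fin n) (m : ℕ)
    (f : S) : ((restrictedMul S i ^ m) f : Hardy n) = (coordMul n i ^ m) f := by
  induction m with
  | zero => rfl
  | succ m ih => rw [pow_succ', pow_succ', mul_apply_eq_comp, mul_apply_eq_comp,
      coe_restrictedMul hS, ih]

theorem coe_star_restrictedMul_pow [CompleteSpace S] (hS : IsInvariantSubspace S) (i : Fin n)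
    (m : ℕ) (f : S) : (star (restrictedMul S i ^ m) f : Hardy n) =
      S.starProjection (star (coordMul n i ^ m) f) := by
  rw [Submodule.starProjection_apply]
  congr 1
  refine ext_inner_left ℂ fun g => ?_
  rw [ContinuousLinearMap.star_eq_adjoint, ContinuousLinearMap.adjoint_inner_right,
    Submodule.coe_inner, coe_restrictedMul_pow hS, ContinuousLinearMap.star_eq_adjoint,
    Submodule.inner_orthogonalProjectionOnto_eq_of_mem_left,
    ContinuousLinearMap.adjoint_inner_right]

theorem restrictedMul_mem [CompleteSpace S] (i : Fin n) : restrictedMul S i ∈ toeplitzAlgebra S :=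
  subset_operatorCstarAlgebra _ ⟨i, rfl⟩

theorem isClosed_toeplitzAlgebra [CompleteSpace S] :
    IsClosed (toeplitzAlgebra S : Set (S →L[ℂ] S)) :=
  isClosed_operatorCstarAlgebra _

theorem finiteDimensional_orthogonal_of_quotient [CompleteSpace S]
    (hfin : FiniteDimensional ℂ (Hardy n ⧸ S)) : FiniteDimensional ℂ Sᗮ :=
  (Submodule.quotientEquivOfIsCompl S Sᗮ S.isCompl_orthogonal).finiteDimensional

/-- A polynomial in one coordinate multiplies the Hardy space into `S`. -/
theorem exists_polynomial_mul_mem (hS : IsInvariantSubspace S)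
    (hfin : FiniteDimensional ℂ (Hardy n ⧸ S)) (i : Fin n) :
    ∃ p : Polynomial ℂ, p ≠ 0 ∧ ∀ f, Polynomial.aeval (coordMul n i) p f ∈ S := by
  -- `g` is the multiplication induced on the finite-dimensional quotient; its minimal polynomial
  -- annihilates it, which says that the same polynomial in `M_{z_i}` maps everything into `S`.
  let g : Module.End ℂ (Hardy n ⧸ S) :=
    S.mapQ S (coordMul n i : Hardy n →ₗ[ℂ] Hardy n) fun f hf => hS.2 i f hf
  have hg : ∀ p : Polynomial ℂ, ∀ f, S.mkQ (Polynomial.aeval (coordMul n i) p f) =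
      Polynomial.aeval g p (S.mkQ f) := by
    intro p
    induction p using Polynomial.induction_on' with
    | add p q hp hq =>
      intro f
      simp only [map_add, _root_.add_apply, LinearMap.add_apply, hp, hq]
    | monomial k c =>
      intro f
      have hk : ∀ k : ℕ, S.mkQ ((coordMul n i ^ k) f) = (g ^ k) (S.mkQ f) := by
        intro k
        induction k with
        | zero => rfl
        | succ k ih =>
          rw [pow_succ', pow_succ', mul_apply_eq_comp, Module.End.mul_apply, ← ih]
          rfl
      rw [Polynomial.aeval_monomial, Polynomial.aeval_monomial, ← Algebra.smul_def,
        ← Algebra.smul_def, _root_.smul_apply, map_smul, hk, LinearMap.smul_apply]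
  refine ⟨minpoly ℂ g, minpoly.ne_zero (Algebra.IsIntegral.isIntegral g), fun f => ?_⟩
  have := hg (minpoly ℂ g) f
  rw [minpoly.aeval, LinearMap.zero_apply] at this
  simpa using this

theorem coe_aeval_restrictedMul [CompleteSpace S] (hS : IsInvariantSubspace S) (i : Fin n)
    (p : Polynomial ℂ) (f : S) : (Polynomial.aeval (restrictedMul S i) p f : Hardy n) =
      Polynomial.aeval (coordMul n i) p f := by
  induction p using Polynomial.induction_on' with
  | add p q hp hq =>
    rw [map_add, map_add, _root_.add_apply, _root_.add_apply, Submodule.coe_add, hp, hq]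
  | monomial k c =>
    rw [Polynomial.aeval_monomial, Polynomial.aeval_monomial, ← Algebra.smul_def,
      ← Algebra.smul_def, _root_.smul_apply, _root_.smul_apply, Submodule.coe_smul,
      coe_restrictedMul_pow hS]

theorem aeval_coordMul_monomial_ne_zero (i : Fin n) {p : Polynomial ℂ} (hp : p ≠ 0) :
    Polynomial.aeval (coordMul n i) p (monomial 0) ≠ 0 := by
  intro h
  refine hp (Polynomial.ext fun j => ?_)
  have h1 := congrArg (fun f : Hardy n => f (Pi.single i j)) h
  have hk : ∀ k : ℕ, (coordMul n i ^ k) (monomial 0) = monomial (Pi.single i k) := by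
    intro k
    induction k with
    | zero => simp
    | succ k ih =>
      rw [pow_succ', mul_apply_eq_comp, ih, coordMul_monomial, ← Pi.single_add]
  have h2 : Polynomial.aeval (coordMul n i) p (monomial 0) =
      ∑ k ∈ p.support, p.coeff k • monomial (Pi.single i k) := by
    rw [Polynomial.aeval_def, Polynomial.eval₂_eq_sum, Polynomial.sum_def, _root_.sum_apply]
    refine Finset.sum_congr rfl fun k _ => ?_
    rw [← Algebra.smul_def, _root_.smul_apply, hk]
  rw [h2] at h1
  simp only [lp.coeFn_sum, Finset.sum_apply, lp.coeFn_smul, Pi.smul_apply, monomial_apply,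
    smul_eq_mul] at h1
  simpa [(Pi.single_injective i).eq_iff, Pi.single_inj] using h1

/-- On a finite-codimensional invariant subspace, an idempotent commuting with the coordinate
multiplications is trivial. -/
theorem eq_zero_or_eq_one_of_commute [CompleteSpace S] (hS : IsInvariantSubspace S)
    (hfin : FiniteDimensional ℂ (Hardy n ⧸ S)) (hn : 0 < n) {T : S →L[ℂ] S}
    (hT : ∀ f, T (T f) = T f) (hc : ∀ i f, T (restrictedMul S i f) = restrictedMul S i (T f)) :
    T = 0 ∨ T = 1 := by
  obtain ⟨p, hp0, hp⟩ := exists_polynomial_mul_mem hS hfin ⟨0, hn⟩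
  set R := restrictedMul S ⟨0, hn⟩ with hR
  set M := coordMul n ⟨0, hn⟩ with hM
  set D : Hardy n →L[ℂ] S := (Polynomial.aeval M p).codRestrict S hp with hD
  have hMcomm : ∀ i, Commute M (coordMul n i) := fun i => by
    ext f : 1
    refine Hardy.toPowerSeries_injective ?_
    simp only [mul_apply_eq_comp, hM, Hardy.toPowerSeries_coordMul]
    rw [mul_left_comm]
  have hDM : ∀ i f, D (coordMul n i f) = restrictedMul S i (D f) := by
    intro i f
    refine Subtype.ext ?_
    rw [coe_restrictedMul hS]
    have h : Commute (Polynomial.aeval M p) (coordMul n i) :=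
      commute_aeval (hMcomm i) p
    exact congrArg (fun A : Hardy n →L[ℂ] Hardy n => A f) h.eq
  have hDR : ∀ f : S, D f = Polynomial.aeval R p f := fun f =>
    Subtype.ext (coe_aeval_restrictedMul hS _ p f).symm
  have hDT : ∀ f : S, D (T f) = T (D f) := by
    intro f
    have h : Commute (Polynomial.aeval R p) T :=
      commute_aeval (ContinuousLinearMap.ext fun f => (hc _ f).symm) p
    rw [hDR, hDR]
    exact congrArg (fun A : S →L[ℂ] S => A f) h.eq
  have hA : ∀ A : S →L[ℂ] S, (∀ i f, A (restrictedMul S i f) = restrictedMul S i (A f)) →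
      ∀ f, toPowerSeries (A (D f) : Hardy n) =
        toPowerSeries (A (D (monomial 0)) : Hardy n) * toPowerSeries f := by
    intro A hA
    refine Hardy.toPowerSeries_apply_of_commute (A := S.subtypeL ∘L A ∘L D) fun i f => ?_
    simp only [ContinuousLinearMap.comp_apply, Submodule.subtypeL_apply, hDM, hA,
      coe_restrictedMul hS]
  have hD1 := hA 1 fun _ _ => rfl
  simp only [one_apply_eq_self] at hD1
  have hDne : toPowerSeries (D (monomial 0) : Hardy n) ≠ 0 := by
    intro h
    exact aeval_coordMul_monomial_ne_zero ⟨0, hn⟩ hp0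
      (Hardy.toPowerSeries_injective (h.trans (map_zero _).symm))
  have hDinj : ∀ f, D f = 0 → f = 0 := by
    intro f hf
    have := hD1 f
    rw [hf, Submodule.coe_zero, map_zero] at this
    exact Hardy.toPowerSeries_injective
      (((mul_eq_zero.1 this.symm).resolve_left hDne).trans (map_zero _).symm)
  -- With `d` the power series of `D 1`, idempotency of `T` reads `d u = u u`. So either `u = d`,
  -- giving `T D = D`, or `u = 0`, giving `T D = 0`; injectivity of `D` passes this on to `T`.
  set u := T (D (monomial 0)) with hu
  have h1 := hA T hc (u : Hardy n)
  rw [← hDT, hu, hT, ← hu, hD1] at h1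
  rcases mul_eq_zero.1 (show
    (toPowerSeries (D (monomial 0) : Hardy n) - toPowerSeries (u : Hardy n)) *
    toPowerSeries (u : Hardy n) = 0 by rw [sub_mul, h1, sub_self]) with h | h
  · right
    ext1 f
    have h2 := hA T hc (f : Hardy n)
    rw [← hu, ← sub_eq_zero.1 h, ← hD1, ← hDT] at h2
    have h3 : D (T f - f : S) = 0 := by
      rw [Submodule.coe_sub, map_sub, sub_eq_zero]
      exact Subtype.ext (Hardy.toPowerSeries_injective h2)
    exact sub_eq_zero.1 (Subtype.ext (hDinj _ h3))
  · left
    ext1 f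
    have h2 := hA T hc (f : Hardy n)
    rw [← hu, h, zero_mul, ← hDT, ← map_zero toPowerSeries] at h2
    exact Subtype.ext (hDinj _ (Subtype.ext (Hardy.toPowerSeries_injective h2)))

/-- The Toeplitz algebra of a finite-codimensional invariant subspace acts irreducibly. -/
theorem dense_toeplitzAlgebra_apply [CompleteSpace S] (hS : IsInvariantSubspace S)
    (hfin : FiniteDimensional ℂ (Hardy n ⧸ S)) (hn : 0 < n) (e : S) (he : e ≠ 0) :
    Dense {y | ∃ X ∈ toeplitzAlgebra S, X e = y} := by
  let N₀ : Submodule ℂ S := (toeplitzAlgebra S).toSubalgebra.toSubmodule.map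
    (ContinuousLinearMap.apply ℂ S e : (S →L[ℂ] S) →ₗ[ℂ] S)
  have hN₀ : (N₀ : Set S) = {y | ∃ X ∈ toeplitzAlgebra S, X e = y} := rfl
  let N := N₀.topologicalClosure
  have hinv : ∀ X ∈ toeplitzAlgebra S, ∀ y ∈ N, X y ∈ N := by
    intro X hX y hy
    refine (closure_minimal (t := {y | X y ∈ (N : Set S)}) ?_
      (N₀.isClosed_topologicalClosure.preimage X.continuous)) hy
    rintro _ ⟨Y, hY, rfl⟩
    exact N₀.le_topologicalClosure ⟨X * Y, mul_mem (S := StarSubalgebra ℂ (S →L[ℂ] S)) hX hY, rfl⟩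
  have : CompleteSpace N := N₀.isClosed_topologicalClosure.completeSpace_coe
  have heN : e ∈ N := N₀.le_topologicalClosure ⟨1, one_mem (toeplitzAlgebra S), rfl⟩
  -- The closed orbit `N` is invariant under a star algebra, so it reduces every `R_{z_i}` and its
  -- projection commutes with them; that projection is not `0` since `N` contains `e`.
  have hP := eq_zero_or_eq_one_of_commute hS hfin hn (T := N.starProjection) (fun f => by
      rw [Submodule.starProjection_eq_self_iff]
      exact N.starProjection_apply_mem f) (fun i f => by
    refine Submodule.eq_starProjection_of_mem_orthogonal
      (hinv _ (restrictedMul_mem i) _ (N.starProjection_apply_mem f)) ?_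
    rw [← map_sub, Submodule.mem_orthogonal]
    intro y hy
    rw [← ContinuousLinearMap.adjoint_inner_left, ← ContinuousLinearMap.star_eq_adjoint]
    exact Submodule.inner_right_of_mem_orthogonal (hinv _ (star_mem (restrictedMul_mem i)) _ hy)
      (N.sub_starProjection_mem_orthogonal f))
  rcases hP with h | h
  · refine (he ?_).elim
    rw [← Submodule.starProjection_eq_self_iff.2 heN, h]
    rfl
  · rw [← hN₀]
    intro y
    have : N.starProjection y = y := by rw [h]; rfl
    exact Submodule.starProjection_eq_self_iff.1 this

/-- For every nonzero `x ∈ S` some element of the Toeplitz algebra does not annihilate `x` and has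
range, up to finite dimension, in the functions with exponents bounded in the given directions. -/
theorem exists_mem_toeplitzAlgebra_bounded [CompleteSpace S] (hS : IsInvariantSubspace S)
    (hfin : FiniteDimensional ℂ (Hardy n ⧸ S)) (s : Finset (Fin n)) (x : S) (hx : x ≠ 0) :
    ∃ A ∈ toeplitzAlgebra S, A x ≠ 0 ∧ ∃ (W : Submodule ℂ (Hardy n)) (K : ℕ),
      FiniteDimensional ℂ W ∧ ∀ y, (A y : Hardy n) ∈ W ⊔ coordSubspace {k | ∀ i ∈ s, k i < K} := by
  classical
  have hQ := finiteDimensional_orthogonal_of_quotient hfin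
  induction s using Finset.induction_on with
  | empty =>
    refine ⟨1, one_mem _, hx, ⊥, 0, inferInstance, fun y => Submodule.mem_sup_right ?_⟩
    intro k hk
    exact (hk (by simp)).elim
  | insert i s _ ih =>
    obtain ⟨A, hA, hAx, W, K, hW, hAW⟩ := ih
    -- Otherwise `A x` would be divisible by every power of `z_i`: taking `m = k i + 1` annihilates
    -- its coefficient at `k`.
    obtain ⟨m, hm⟩ : ∃ m : ℕ,
        (1 - restrictedMul S i ^ m * star (restrictedMul S i ^ m)) (A x) ≠ 0 := by
      by_contra! h
      refine hAx (Subtype.ext (lp.ext (funext fun k => ?_)))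
      have h1 := h (k i + 1)
      rw [_root_.sub_apply, one_apply_eq_self, sub_eq_zero, mul_apply_eq_comp] at h1
      rw [h1, coe_restrictedMul_pow hS, coordMul_pow_apply, if_pos (by omega)]
      rfl
    set E : Hardy n →L[ℂ] Hardy n := 1 - coordMul n i ^ m * star (coordMul n i ^ m) with hE
    have hEapp : ∀ f k, E f k = if k i < m then f k else 0 := by
      intro f k
      rw [hE, _root_.sub_apply, one_apply_eq_self, lp.coeFn_sub, Pi.sub_apply,
        coordMul_pow_mul_star_apply]
      split_ifs <;> simp
    refine ⟨(1 - restrictedMul S i ^ m * star (restrictedMul S i ^ m)) * A,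
      mul_mem (sub_mem (one_mem _) (mul_mem (pow_mem (restrictedMul_mem i) m)
        (star_mem (pow_mem (restrictedMul_mem i) m)))) hA, hm,
      W.map (E : Hardy n →ₗ[ℂ] Hardy n) ⊔
        Sᗮ.map ((coordMul n i ^ m : Hardy n →L[ℂ] Hardy n) : Hardy n →ₗ[ℂ] Hardy n),
      max K m, inferInstance, fun y => ?_⟩
    -- Since `R^{*m}` is `P_S M^{*m}`, the cutoff built on `S` differs from the cutoff `E` of the
    -- whole space by `M^m P_{S^⊥} M^{*m}`, whose range lies in the finite-dimensional `M^m S^⊥`.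
    have h1 : (((1 - restrictedMul S i ^ m * star (restrictedMul S i ^ m)) * A) y : Hardy n) =
        E (A y) + (coordMul n i ^ m) (Sᗮ.starProjection (star (coordMul n i ^ m) (A y))) := by
      rw [mul_apply_eq_comp, _root_.sub_apply, one_apply_eq_self, Submodule.coe_sub,
        mul_apply_eq_comp, coe_restrictedMul_pow hS, coe_star_restrictedMul_pow hS,
        Submodule.starProjection_orthogonal_val, map_sub, hE, _root_.sub_apply,
        one_apply_eq_self, mul_apply_eq_comp]
      abel
    rw [h1]
    obtain ⟨w, hw, f, hf, hwf⟩ := Submodule.mem_sup.1 (hAW y)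
    rw [← hwf, map_add E, add_right_comm]
    refine add_mem (Submodule.mem_sup_left (add_mem (Submodule.mem_sup_left ⟨w, hw, rfl⟩)
      (Submodule.mem_sup_right ⟨_, Submodule.starProjection_apply_mem _ _, rfl⟩)))
      (Submodule.mem_sup_right fun k hk => ?_)
    rw [hEapp]
    split_ifs with hkm
    · refine hf k fun hk' => hk ?_
      intro j hj
      rcases Finset.mem_insert.1 hj with rfl | hj
      · exact lt_max_of_lt_right hkm
      · exact lt_max_of_lt_left (hk' j hj)
    · rfl

/-- Once the exponents are bounded in all directions only finitely many monomials remain, so the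
operator produced by `exists_mem_toeplitzAlgebra_bounded` is a nonzero one of finite rank;
irreducibility does the rest. -/
theorem mem_toeplitzAlgebra_of_finiteDimensional_range [CompleteSpace S]
    (hS : IsInvariantSubspace S) (hfin : FiniteDimensional ℂ (Hardy n ⧸ S)) (hn : 0 < n)
    (T : S →L[ℂ] S) (hT : FiniteDimensional ℂ T.range) : T ∈ toeplitzAlgebra S := by
  by_cases h : ∃ x : S, x ≠ 0
  · obtain ⟨x, hx⟩ := h
    obtain ⟨A, hA, hAx, W, K, hW, hAW⟩ :=
      exists_mem_toeplitzAlgebra_bounded hS hfin Finset.univ x hx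
    have hfinite : Finite {k : Fin n → ℕ | ∀ i ∈ Finset.univ, k i < K} :=
      (Set.Finite.pi' fun _ : Fin n => Set.finite_lt_nat K).subset fun k hk i =>
        hk i (Finset.mem_univ i)
    have h1 := (coordSubspaceEquiv
      {k : Fin n → ℕ | ∀ i ∈ Finset.univ, k i < K}).symm.finiteDimensional
    refine mem_of_finiteDimensional_range isClosed_toeplitzAlgebra
      (dense_toeplitzAlgebra_apply hS hfin hn) hA (fun h0 => hAx (by rw [h0]; rfl)) ?_ T hT
    have h2 : FiniteDimensional ℂ (A.range.map S.subtype) := by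
      refine Submodule.finiteDimensional_of_le 
        (S₂ := W ⊔ coordSubspace {k | ∀ i ∈ Finset.univ, k i < K}) ?_
      rintro _ ⟨_, ⟨y, rfl⟩, rfl⟩
      exact hAW y
    exact (A.range.equivMapOfInjective S.subtype S.subtype_injective).symm.finiteDimensional
  · push Not at h
    have : T = 0 := by
      ext1 x
      rw [h x, map_zero, map_zero]
    rw [this]
    exact zero_mem _

end Invariant

/-! ### Toeplitz algebras as corners of the Toeplitz algebra of the polydisc -/

/-- The C*-algebra generated by the coordinate multiplications on the Hardy space. -/
def polydiscToeplitz (n : ℕ) : StarSubalgebra ℂ (Hardy n →L[ℂ] Hardy n) :=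
  operatorCstarAlgebra (Set.range (coordMul n))

theorem coordMul_mem_polydiscToeplitz {n : ℕ} (i : Fin n) : coordMul n i ∈ polydiscToeplitz n :=
  subset_operatorCstarAlgebra _ ⟨i, rfl⟩

theorem isClosed_polydiscToeplitz (n : ℕ) :
    IsClosed (polydiscToeplitz n : Set (Hardy n →L[ℂ] Hardy n)) :=
  isClosed_operatorCstarAlgebra _

theorem operatorCstarAlgebra_induction {H : Type} [NormedAddCommGroup H] [InnerProductSpace ℂ H]
    [CompleteSpace H] {s : Set (H →L[ℂ] H)} {p : (H →L[ℂ] H) → Prop}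
    (hcl : IsClosed {T | p T}) (hmem : ∀ T ∈ s, p T) (hone : ∀ c : ℂ, p (c • 1))
    (hadd : ∀ T T', p T → p T' → p (T + T')) (hmul : ∀ T T', p T → p T' → p (T * T'))
    (hstar : ∀ T, p T → p (star T)) {T : H →L[ℂ] H} (hT : T ∈ operatorCstarAlgebra s) : p T := by
  have hsub : ∀ T ∈ StarAlgebra.adjoin ℂ s, p T := by
    intro T hT
    induction hT using StarAlgebra.adjoin_induction with
    | mem T hT => exact hmem T hT
    | algebraMap c =>
      rw [Algebra.algebraMap_eq_smul_one]
      exact hone c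
    | add T T' _ _ h h' => exact hadd T T' h h'
    | mul T T' _ _ h h' => exact hmul T T' h h'
    | star T _ h => exact hstar T h
  exact closure_minimal (t := {T | p T}) hsub hcl hT

section Corner

variable {n : ℕ} {S : Submodule ℂ (Hardy n)}

/-- The operator on `H²(𝔻ⁿ)` which is `T` on `S` and zero on the orthogonal complement. -/
def extendByZero (S : Submodule ℂ (Hardy n)) [CompleteSpace S] (T : S →L[ℂ] S) :
    Hardy n →L[ℂ] Hardy n :=
  S.subtypeL ∘L T ∘L S.orthogonalProjectionOnto

/-- The compression of an operator to `S`. -/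
def compression (S : Submodule ℂ (Hardy n)) [CompleteSpace S] (A : Hardy n →L[ℂ] Hardy n) :
    S →L[ℂ] S :=
  S.orthogonalProjectionOnto ∘L A ∘L S.subtypeL

theorem compression_extendByZero [CompleteSpace S] (T : S →L[ℂ] S) :
    compression S (extendByZero S T) = T := by
  ext1 f
  simp [compression, extendByZero]

theorem star_extendByZero [CompleteSpace S] (T : S →L[ℂ] S) :
    star (extendByZero S T) = extendByZero S (star T) := by
  simp only [extendByZero, ContinuousLinearMap.star_eq_adjoint, ContinuousLinearMap.adjoint_comp,
    Submodule.adjoint_orthogonalProjectionOnto, Submodule.adjoint_subtypeL]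
  rfl

theorem star_compression [CompleteSpace S] (A : Hardy n →L[ℂ] Hardy n) :
    star (compression S A) = compression S (star A) := by
  simp only [compression, ContinuousLinearMap.star_eq_adjoint, ContinuousLinearMap.adjoint_comp,
    Submodule.adjoint_orthogonalProjectionOnto, Submodule.adjoint_subtypeL]
  rfl

theorem extendByZero_mul [CompleteSpace S] (T T' : S →L[ℂ] S) :
    extendByZero S (T * T') = extendByZero S T * extendByZero S T' := by
  ext1 f
  simp [extendByZero]

theorem extendByZero_restrictedMul [CompleteSpace S] (i : Fin n) :
    extendByZero S (restrictedMul S i) = S.starProjection * coordMul n i * S.starProjection := rfl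

/-- Extension by zero preserves sums, products and adjoints and sends `1` to `P_S`, so only the
generators `P_S M_{z_i} P_S` have to be checked. -/
theorem extendByZero_mem [CompleteSpace S] (hP : S.starProjection ∈ polydiscToeplitz n)
    {T : S →L[ℂ] S} (hT : T ∈ toeplitzAlgebra S) : extendByZero S T ∈ polydiscToeplitz n := by
  have hcont : Continuous (extendByZero S) := by
    unfold extendByZero
    fun_prop
  refine operatorCstarAlgebra_induction (p := fun T => extendByZero S T ∈ polydiscToeplitz n)
    ((isClosed_polydiscToeplitz n).preimage hcont) ?_ (fun c => ?_) (fun T T' h h' => ?_)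
    (fun T T' h h' => ?_) (fun T h => ?_) hT
  · rintro _ ⟨i, rfl⟩
    rw [extendByZero_restrictedMul]
    exact mul_mem (mul_mem hP (coordMul_mem_polydiscToeplitz i)) hP
  · have : extendByZero S (c • 1) = c • S.starProjection := by
      ext1 f
      simp [extendByZero]
    rw [this]
    exact SMulMemClass.smul_mem c hP
  · have : extendByZero S (T + T') = extendByZero S T + extendByZero S T' := by
      ext1 f
      simp [extendByZero]
    rw [this]
    exact add_mem h h'
  · rw [extendByZero_mul]
    exact mul_mem h h'
  · rw [← star_extendByZero]
    exact star_mem h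

/-- The whole space is an invariant subspace of codimension zero, so the finite rank result for
`T(S)` applies to it. -/
theorem mem_polydiscToeplitz_of_finiteDimensional_range (hn : 0 < n) (T : Hardy n →L[ℂ] Hardy n)
    (hT : FiniteDimensional ℂ T.range) : T ∈ polydiscToeplitz n := by
  have h1 : IsInvariantSubspace (⊤ : Submodule ℂ (Hardy n)) :=
    ⟨isClosed_univ, fun _ _ _ => trivial⟩
  have : CompleteSpace (⊤ : Submodule ℂ (Hardy n)) := h1.1.completeSpace_coe
  have h2 : extendByZero ⊤ (compression ⊤ T) = T := by
    ext1 f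
    simp [extendByZero, compression, Submodule.starProjection_top']
  rw [← h2]
  refine extendByZero_mem (by rw [Submodule.starProjection_top']; exact one_mem _)
    (mem_toeplitzAlgebra_of_finiteDimensional_range h1 inferInstance hn _ ?_)
  refine Submodule.finiteDimensional_of_le (S₂ := T.range.map
    ((⊤ : Submodule ℂ (Hardy n)).orthogonalProjectionOnto : Hardy n →ₗ[ℂ] _)) ?_
  rintro _ ⟨f, rfl⟩
  exact ⟨T f, ⟨f, rfl⟩, rfl⟩

theorem starProjection_mem_of_finiteDimensional (hn : 0 < n) (W : Submodule ℂ (Hardy n))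
    [FiniteDimensional ℂ W] : W.starProjection ∈ polydiscToeplitz n := by
  refine mem_polydiscToeplitz_of_finiteDimensional_range hn _ ?_
  rw [Submodule.range_starProjection]
  infer_instance

theorem starProjection_mem_of_orthogonal [CompleteSpace S] (hn : 0 < n)
    (hQ : FiniteDimensional ℂ Sᗮ) : S.starProjection ∈ polydiscToeplitz n := by
  have := starProjection_mem_of_finiteDimensional hn Sᗮ
  rw [Submodule.starProjection_orthogonal'] at this
  simpa using sub_mem (one_mem (polydiscToeplitz n)) this

/-- Compression to `S` is not multiplicative, but its defect on `A B` factors through `S^⊥`. It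
therefore has finite rank and already belongs to `T(S)`. -/
theorem compression_mem [CompleteSpace S] (hS : IsInvariantSubspace S)
    (hfin : FiniteDimensional ℂ (Hardy n ⧸ S)) (hn : 0 < n) {A : Hardy n →L[ℂ] Hardy n}
    (hA : A ∈ polydiscToeplitz n) : compression S A ∈ toeplitzAlgebra S := by
  have hQ := finiteDimensional_orthogonal_of_quotient hfin
  have hcont : Continuous (compression S) := by
    unfold compression
    fun_prop
  refine operatorCstarAlgebra_induction (p := fun A => compression S A ∈ toeplitzAlgebra S)
    (isClosed_toeplitzAlgebra.preimage hcont) ?_ (fun c => ?_) (fun A B h h' => ?_)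
    (fun A B h h' => ?_) (fun A h => ?_) hA
  · rintro _ ⟨i, rfl⟩
    exact restrictedMul_mem i
  · have : compression S (c • 1) = c • 1 := by
      ext1 f
      simp [compression]
    rw [this]
    exact SMulMemClass.smul_mem c (one_mem _)
  · have : compression S (A + B) = compression S A + compression S B := by
      ext1 f
      simp [compression]
    rw [this]
    exact add_mem h h'
  · have h1 : compression S (A * B) = compression S A * compression S B +
        compression S (A * (Sᗮ.starProjection * B)) := by
      ext1 f
      simp only [compression, mul_apply_eq_comp, ContinuousLinearMap.comp_apply,
        _root_.add_apply, Submodule.subtypeL_apply]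
      rw [← map_add, ← map_add, ← Submodule.starProjection_apply,
        Submodule.starProjection_add_starProjection_orthogonal]
    have h2 : compression S (A * (Sᗮ.starProjection * B)) ∈ toeplitzAlgebra S := by
      refine mem_toeplitzAlgebra_of_finiteDimensional_range hS hfin hn _ ?_
      refine Submodule.finiteDimensional_of_le (S₂ := Sᗮ.map
        ((S.orthogonalProjectionOnto ∘L A : Hardy n →L[ℂ] S) : Hardy n →ₗ[ℂ] S)) ?_
      rintro _ ⟨f, rfl⟩
      exact ⟨_, Submodule.starProjection_apply_mem _ (B f), rfl⟩
    rw [h1]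
    exact add_mem (mul_mem h h') h2
  · rw [← star_compression]
    exact star_mem h

/-- The Toeplitz algebra of a finite-codimensional invariant subspace is a corner of the Toeplitz
algebra of the polydisc. -/
theorem mem_toeplitzAlgebra_iff [CompleteSpace S] (hS : IsInvariantSubspace S)
    (hfin : FiniteDimensional ℂ (Hardy n ⧸ S)) (hn : 0 < n) (T : S →L[ℂ] S) :
    T ∈ toeplitzAlgebra S ↔ extendByZero S T ∈ polydiscToeplitz n := by
  refine ⟨extendByZero_mem (starProjection_mem_of_orthogonal hn
    (finiteDimensional_orthogonal_of_quotient hfin)), fun h => ?_⟩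
  rw [← compression_extendByZero T]
  exact compression_mem hS hfin hn h

/-- A unitary between finite-codimensional invariant subspaces which belongs to the Toeplitz algebra
of the polydisc intertwines their Toeplitz algebras. -/
theorem intertwines_of_mem {S' : Submodule ℂ (Hardy n)} [CompleteSpace S] [CompleteSpace S']
    (hS : IsInvariantSubspace S) (hfin : FiniteDimensional ℂ (Hardy n ⧸ S))
    (hS' : IsInvariantSubspace S') (hfin' : FiniteDimensional ℂ (Hardy n ⧸ S')) (hn : 0 < n)
    (U : S ≃ₗᵢ[ℂ] S')
    (hU : S'.subtypeL ∘L (U : S →L[ℂ] S') ∘L S.orthogonalProjectionOnto ∈ polydiscToeplitz n) :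
    Intertwines U ∧ Intertwines U.symm := by
  set W := S'.subtypeL ∘L (U : S →L[ℂ] S') ∘L S.orthogonalProjectionOnto with hW
  have hWstar : star W = S.subtypeL ∘L (U.symm : S' →L[ℂ] S) ∘L S'.orthogonalProjectionOnto := by
    simp only [hW, ContinuousLinearMap.star_eq_adjoint, ContinuousLinearMap.adjoint_comp,
      Submodule.adjoint_orthogonalProjectionOnto, Submodule.adjoint_subtypeL,
      LinearIsometryEquiv.adjoint_eq_symm]
    rfl
  -- On extensions by zero, conjugation by `U` is `T ↦ W T W^*` with `W` in `𝒯`; the corner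
  -- criterion translates this back to the two algebras.
  have h1 : ∀ T ∈ toeplitzAlgebra S,
      (U : S →L[ℂ] S') ∘L T ∘L (U.symm : S' →L[ℂ] S) ∈ toeplitzAlgebra S' := by
    intro T hT
    rw [mem_toeplitzAlgebra_iff hS' hfin' hn]
    have : extendByZero S' ((U : S →L[ℂ] S') ∘L T ∘L (U.symm : S' →L[ℂ] S)) =
        W * extendByZero S T * star W := by
      rw [hWstar]
      ext1 f
      simp [extendByZero, hW]
    rw [this]
    exact mul_mem (mul_mem hU ((mem_toeplitzAlgebra_iff hS hfin hn T).1 hT)) (star_mem hU)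
  have h2 : ∀ T ∈ toeplitzAlgebra S',
      (U.symm : S' →L[ℂ] S) ∘L T ∘L (U : S →L[ℂ] S') ∈ toeplitzAlgebra S := by
    intro T hT
    rw [mem_toeplitzAlgebra_iff hS hfin hn]
    have : extendByZero S ((U.symm : S' →L[ℂ] S) ∘L T ∘L (U : S →L[ℂ] S')) =
        star W * extendByZero S' T * W := by
      rw [hWstar]
      ext1 f
      simp [extendByZero, hW]
    rw [this]
    exact mul_mem (mul_mem (star_mem hU) ((mem_toeplitzAlgebra_iff hS' hfin' hn T).1 hT)) hU
  constructor
  · refine Set.Subset.antisymm ?_ fun T hT => ⟨_, h2 T hT, ?_⟩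
    · rintro _ ⟨T, hT, rfl⟩
      exact h1 T hT
    · ext1 f
      simp
  · refine Set.Subset.antisymm ?_ fun T hT => ⟨_, h1 T hT, ?_⟩
    · rintro _ ⟨T, hT, rfl⟩
      exact h2 T hT
    · ext1 f
      simp

end Corner

/-! ### The Hardy space of the disc -/

theorem hasSum_prod_pi (n : ℕ) (g : Fin n → ℕ → ℂ) (hg : ∀ i, Summable fun k => ‖g i k‖) :
    HasSum (fun k : Fin n → ℕ => ∏ i, g i (k i)) (∏ i, ∑' k, g i k) := by
  induction n with
  | zero =>
    simp
  | succ n ih =>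
    have h1 := ih (fun i => g i.succ) fun i => hg i.succ
    have hs : Summable fun k : Fin n → ℕ => ‖∏ i, g i.succ (k i)‖ := by
      have h2 : ∀ i : Fin n, Summable ((fun (i : Fin n) (k : ℕ) => ‖g i.succ k‖) i) := fun i =>
        hg i.succ
      have h3 := summable_prod_pi n _ (fun i k => norm_nonneg (g i.succ k)) h2
      exact h3.congr fun k => (norm_prod _ _).symm
    have h0 : HasSum (g 0) (∑' k, g 0 k) := (hg 0).of_norm.hasSum
    generalize hG : (fun k : Fin n → ℕ => ∏ i, g i.succ (k i)) = G at h1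
    have hs' : Summable fun k => ‖G k‖ := by
      rw [← hG]
      exact hs
    have h2 := h0.mul h1 (summable_mul_of_summable_norm (hg 0) hs')
    rw [Fin.prod_univ_succ]
    refine ((Fin.consEquiv (fun _ : Fin (n + 1) => ℕ)).hasSum_iff).1 (h2.congr_fun ?_)
    intro p
    simp [← hG, Fin.prod_univ_succ, Fin.consEquiv]

theorem hardyTensor_apply {n : ℕ} (f : Fin n → HardyDisc) (k : Fin n → ℕ) :
    hardyTensor f k = ∏ i, f i (k i) := rfl

theorem hardyTensor_val {n : ℕ} (f : Fin n → HardyDisc) {z : Fin n → ℂ} (hz : ∀ i, ‖z i‖ < 1) :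
    (hardyTensor f).val z = ∏ i, (f i).val (z i) := by
  refine HasSum.tsum_eq ?_
  refine (hasSum_prod_pi n (fun i k => f i k * z i ^ k)
    fun i => ((f i).summable_val (hz i)).norm).congr_fun fun k => ?_
  rw [hardyTensor_apply, Finset.prod_mul_distrib]

theorem inner_hardyTensor {n : ℕ} (f g : Fin n → HardyDisc) :
    (inner ℂ (hardyTensor f) (hardyTensor g) : ℂ) = ∏ i, inner ℂ (f i) (g i) := by
  have hs : ∀ i, Summable fun k => (inner ℂ (f i k) (g i k) : ℂ) := fun i =>
    lp.summable_inner (f i) (g i)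
  have h := hasSum_prod_pi n (fun i k => (inner ℂ (f i k) (g i k) : ℂ)) fun i => (hs i).norm
  have hi : ∀ i, (inner ℂ (f i) (g i) : ℂ) = ∑' k, inner ℂ (f i k) (g i k) := fun i =>
    lp.inner_eq_tsum (f i) (g i)
  rw [Finset.prod_congr rfl fun i _ => hi i]
  refine (lp.inner_eq_tsum _ _).trans (Eq.trans (tsum_congr fun k => ?_) h.tsum_eq)
  simp only [hardyTensor_apply, RCLike.inner_apply, map_prod, Finset.prod_mul_distrib]

namespace HardyDisc

theorem val_inj {f g : HardyDisc} (h : ∀ z : ℂ, ‖z‖ < 1 → f.val z = g.val z) : f = g := by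
  have h1 : hardyTensor (fun _ : Fin 1 => f) = hardyTensor (fun _ : Fin 1 => g) := by
    refine Hardy.val_inj fun z hz => ?_
    rw [hardyTensor_val _ hz, hardyTensor_val _ hz]
    exact Finset.prod_congr rfl fun i _ => h _ (hz i)
  ext k
  have := congrArg (fun F : Hardy 1 => F fun _ => k) h1
  simpa [hardyTensor_apply] using this

/-- The monomial `z^k`. -/
def monomial (k : ℕ) : HardyDisc := lp.single 2 k (1 : ℂ)

theorem monomial_apply (k l : ℕ) : monomial k l = if l = k then 1 else 0 := by
  unfold monomial
  split_ifs with h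
  · subst h
    simp
  · exact lp.single_apply_ne 2 k 1 h

theorem inner_monomial (k : ℕ) (f : HardyDisc) : inner ℂ (monomial k) f = f k := by
  unfold monomial
  rw [lp.inner_single_left]
  simp

theorem monomial_val (k : ℕ) (z : ℂ) : (monomial k).val z = z ^ k := by
  unfold val
  rw [tsum_eq_single k fun l hl => by rw [monomial_apply, if_neg hl, zero_mul]]
  rw [monomial_apply, if_pos rfl, one_mul]

theorem val_zero_eq (f : HardyDisc) : f.val 0 = f 0 := by
  unfold val
  rw [tsum_eq_single 0 fun l hl => by rw [zero_pow hl, mul_zero]]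
  simp

/-- The Taylor coefficients of `z f`. -/
def shiftCoeff (a : ℕ → ℂ) : ℕ → ℂ
  | 0 => 0
  | k + 1 => a k

theorem memℓp_shiftCoeff (f : HardyDisc) : Memℓp (shiftCoeff f) 2 := by
  refine memℓp_gen ((summable_nat_add_iff 1).1 ?_)
  refine (lpTwo_summable_sq f).congr fun k => ?_
  simp [shiftCoeff]

/-- Multiplication by the coordinate on `H²(𝔻)`, as an isometry. -/
def shiftIsometry : HardyDisc →ₗᵢ[ℂ] HardyDisc where
  toFun f := ⟨shiftCoeff f, memℓp_shiftCoeff f⟩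
  map_add' f g := by
    ext k
    cases k with
    | zero => exact (add_zero 0).symm
    | succ k => rfl
  map_smul' c f := by
    ext k
    cases k with
    | zero => exact (smul_zero c).symm
    | succ k => rfl
  norm_map' f := by
    have h2 : (0 : ℝ) < (2 : ENNReal).toReal := by norm_num
    refine (Real.rpow_left_inj (norm_nonneg _) (norm_nonneg _) h2.ne').1 ?_
    rw [lp.norm_rpow_eq_tsum h2, lp.norm_rpow_eq_tsum h2]
    refine ((memℓp_shiftCoeff f).summable h2).tsum_eq_zero_add.trans ?_
    simp [shiftCoeff]

/-- Multiplication by the coordinate on `H²(𝔻)`. -/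
def shift : HardyDisc →L[ℂ] HardyDisc := shiftIsometry.toContinuousLinearMap

theorem shift_zero (f : HardyDisc) : shift f 0 = 0 := rfl

theorem shift_succ (f : HardyDisc) (k : ℕ) : shift f (k + 1) = f k := rfl

theorem shift_monomial (k : ℕ) : shift (monomial k) = monomial (k + 1) := by
  ext l
  cases l with
  | zero => rw [shift_zero, monomial_apply, if_neg (Nat.succ_ne_zero k).symm]
  | succ l => simp [shift_succ, monomial_apply]

theorem shift_val (f : HardyDisc) {z : ℂ} (hz : ‖z‖ < 1) : (shift f).val z = z * f.val z := by
  unfold val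
  rw [((shift f).summable_val hz).tsum_eq_zero_add, shift_zero, zero_mul, zero_add, ← tsum_mul_left]
  refine tsum_congr fun k => ?_
  rw [shift_succ, pow_succ]
  ring

theorem star_shift_apply (f : HardyDisc) (k : ℕ) : star shift f k = f (k + 1) := by
  rw [← inner_monomial, ContinuousLinearMap.star_eq_adjoint,
    ContinuousLinearMap.adjoint_inner_right, shift_monomial, inner_monomial]

theorem star_shift_mul_self : star shift * shift = 1 := by
  ext f k
  rw [mul_apply_eq_comp, star_shift_apply, shift_succ]
  rfl

theorem shift_pow_apply_of_lt (f : HardyDisc) {m k : ℕ} (hk : k < m) : (shift ^ m) f k = 0 := by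
  induction m generalizing k with
  | zero => omega
  | succ m ih =>
    rw [pow_succ', mul_apply_eq_comp]
    cases k with
    | zero => exact shift_zero _
    | succ k => exact ih (by omega)

theorem shift_pow_val (f : HardyDisc) (m : ℕ) {z : ℂ} (hz : ‖z‖ < 1) :
    ((shift ^ m) f).val z = z ^ m * f.val z := by
  induction m with
  | zero => simp
  | succ m ih => rw [pow_succ', mul_apply_eq_comp, shift_val _ hz, ih, pow_succ']; ring

/-- Evaluation on the disc, as a linear map. -/
def evalDisc : HardyDisc →ₗ[ℂ] ({z : ℂ // ‖z‖ < 1} → ℂ) where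
  toFun f z := f.val z
  map_add' f g := funext fun z => val_add f g z.2
  map_smul' c f := funext fun z => val_smul c f z

end HardyDisc

namespace IsFiniteBlaschke

variable {φ : ℂ → ℂ}

theorem exists_mul (hφ : IsFiniteBlaschke φ) (f : HardyDisc) :
    ∃ g : HardyDisc, ∀ z : ℂ, ‖z‖ < 1 → g.val z = φ z * f.val z := by
  obtain ⟨B, -, -, hB⟩ := exists_blaschke_operator (𝒜 := ⊤) isClosed_univ
    (M := HardyDisc.shift) trivial HardyDisc.star_shift_mul_self HardyDisc.evalDisc (fun z => z.1)
    (fun z => z.2) (fun f z => HardyDisc.shift_val f z.2) hφ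
  exact ⟨B f, fun z hz => hB f ⟨z, hz⟩⟩

end IsFiniteBlaschke

/-! ### Subspaces of the Hardy space of the disc -/

theorem mem_modelSpace_pow {m : ℕ} {f : HardyDisc} :
    f ∈ modelSpace (fun z => z ^ m) ↔ ∀ k, m ≤ k → f k = 0 := by
  constructor
  · intro hf k hk
    rw [← HardyDisc.inner_monomial]
    refine hf _ ⟨HardyDisc.monomial (k - m), trivial, fun z _ => ?_⟩
    rw [HardyDisc.monomial_val, HardyDisc.monomial_val, ← pow_add, Nat.add_sub_cancel' hk]
  · rintro hf g ⟨h, -, hg⟩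
    have : g = (HardyDisc.shift ^ m) h := HardyDisc.val_inj fun z hz => by
      rw [hg z hz, HardyDisc.shift_pow_val h m hz]
    rw [lp.inner_eq_tsum]
    refine (tsum_congr fun k => ?_).trans tsum_zero
    rcases lt_or_ge k m with hk | hk
    · rw [this, HardyDisc.shift_pow_apply_of_lt h hk, inner_zero_left]
    · rw [hf k hk, inner_zero_right]

theorem apply_zero_of_mem_beurling_id {f : HardyDisc} (hf : f ∈ beurling fun z => z) : f 0 = 0 := by
  obtain ⟨g, -, hg⟩ := hf
  rw [← HardyDisc.val_zero_eq, hg 0 (by simp), zero_mul]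

theorem monomial_mem_beurling_id {k : ℕ} (hk : k ≠ 0) :
    HardyDisc.monomial k ∈ beurling fun z => z := by
  obtain ⟨k, rfl⟩ := Nat.exists_eq_succ_of_ne_zero hk
  refine ⟨HardyDisc.monomial k, trivial, fun z _ => ?_⟩
  rw [HardyDisc.monomial_val, HardyDisc.monomial_val, pow_succ']

theorem apply_of_mem_hardyConst {f : HardyDisc} (hf : f ∈ hardyConst) {k : ℕ} (hk : k ≠ 0) :
    f k = 0 := by
  obtain ⟨c, hc⟩ := hf
  have : f = c • HardyDisc.monomial 0 := HardyDisc.val_inj fun z hz => by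
    rw [hc z hz, HardyDisc.val_smul, HardyDisc.monomial_val, pow_zero, mul_one]
  rw [this, lp.coeFn_smul, Pi.smul_apply, HardyDisc.monomial_apply, if_neg hk, smul_zero]

theorem monomial_zero_mem_hardyConst : HardyDisc.monomial 0 ∈ hardyConst :=
  ⟨1, fun z _ => by rw [HardyDisc.monomial_val, pow_zero]⟩

theorem hardyConst_isOrtho_beurling_id : hardyConst ⟂ beurling fun z => z := by
  rw [Submodule.isOrtho_iff_inner_eq]
  intro f hf g hg
  rw [lp.inner_eq_tsum]
  refine (tsum_congr fun k => ?_).trans tsum_zero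
  by_cases hk : k = 0
  · rw [hk, apply_zero_of_mem_beurling_id hg, inner_zero_right]
  · rw [apply_of_mem_hardyConst hf hk, inner_zero_left]

theorem mulSubspace_isOrtho_modelSpace (θ : ℂ → ℂ) (A : Submodule ℂ HardyDisc) :
    mulSubspace θ A ⟂ modelSpace θ := by
  have h : mulSubspace θ A ≤ beurling θ := by
    rintro g ⟨f, -, hf⟩
    exact ⟨f, trivial, hf⟩
  exact (Submodule.isOrtho_orthogonal_right _).mono_left h

theorem star_shift_mem_modelSpace {θ : ℂ → ℂ} {f : HardyDisc} (hf : f ∈ modelSpace θ) :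
    star HardyDisc.shift f ∈ modelSpace θ := by
  rintro g ⟨h, -, hg⟩
  rw [ContinuousLinearMap.star_eq_adjoint, ContinuousLinearMap.adjoint_inner_right]
  refine hf _ ⟨HardyDisc.shift h, trivial, fun z hz => ?_⟩
  rw [HardyDisc.shift_val _ hz, HardyDisc.shift_val _ hz, hg z hz]
  ring

/-- An eigenvector of the backward shift has geometric coefficients, so its constant term determines
it. -/
theorem finiteDimensional_ker_star_shift_sub (a : ℂ) :
    FiniteDimensional ℂ (star HardyDisc.shift - a • 1 : HardyDisc →L[ℂ] HardyDisc).ker := by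
  let e : (star HardyDisc.shift - a • 1 : HardyDisc →L[ℂ] HardyDisc).ker →ₗ[ℂ] ℂ :=
    { toFun := fun f => (f : HardyDisc) 0
      map_add' := fun _ _ => rfl
      map_smul' := fun _ _ => rfl }
  refine FiniteDimensional.of_injective e ((injective_iff_map_eq_zero e).2 fun f hf => ?_)
  have hrec : ∀ k, (f : HardyDisc) (k + 1) = a * (f : HardyDisc) k := by
    intro k
    have h1 := f.2
    rw [LinearMap.mem_ker, ContinuousLinearMap.coe_coe, _root_.sub_apply, sub_eq_zero] at h1
    rw [← HardyDisc.star_shift_apply, h1]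
    rfl
  refine Subtype.ext (lp.ext (funext fun k => ?_))
  induction k with
  | zero => exact hf
  | succ k ih =>
    rw [hrec, ih]
    exact mul_zero a

/-- Write `φ = c P / Q` with polynomials `P = ∏ (z - a_j)` and `Q = ∏ (1 - ā_j z)`. Then `P h = φ ·
(c⁻¹ Q h)` belongs to `φ H²` for every `h`, so `Q_φ` lies in the kernel of the adjoint of
multiplication by `P`, a product of factors `M_z^* - ā_j` with finite-dimensional kernels. -/
theorem IsFiniteBlaschke.finiteDimensional_modelSpace {φ : ℂ → ℂ} (hφ : IsFiniteBlaschke φ) :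
    FiniteDimensional ℂ (modelSpace φ) := by
  obtain ⟨c, d, a, hc, ha, hφ⟩ := hφ
  have key : ∀ (d : ℕ) (a b : Fin d → ℂ), ∃ P Q : HardyDisc →L[ℂ] HardyDisc,
      (∀ f z, ‖z‖ < 1 → (P f).val z = (∏ j, (z - a j)) * f.val z) ∧
      (∀ f z, ‖z‖ < 1 → (Q f).val z = (∏ j, (1 - b j * z)) * f.val z) ∧
      FiniteDimensional ℂ (star P).ker := by
    intro d
    induction d with
    | zero =>
      refine fun a b => ⟨1, 1, by simp, by simp, ?_⟩
      rw [star_one, show (1 : HardyDisc →L[ℂ] HardyDisc).ker = ⊥ from LinearMap.ker_id]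
      infer_instance
    | succ d ih =>
      intro a b
      obtain ⟨P, Q, hP, hQ, hfd⟩ := ih (fun j => a j.succ) fun j => b j.succ
      have hval : ∀ (s t : ℂ) (f : HardyDisc) (z : ℂ), ‖z‖ < 1 →
          ((s • HardyDisc.shift + t • (1 : HardyDisc →L[ℂ] HardyDisc)) f).val z =
            (s * z + t) * f.val z := by
        intro s t f z hz
        rw [_root_.add_apply, _root_.smul_apply, _root_.smul_apply, one_apply_eq_self,
          HardyDisc.val_add _ _ hz, HardyDisc.val_smul, HardyDisc.val_smul,
          HardyDisc.shift_val _ hz]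
        ring
      refine ⟨P * ((1 : ℂ) • HardyDisc.shift + (-a 0) • 1),
        Q * ((-b 0) • HardyDisc.shift + (1 : ℂ) • 1), fun f z hz => ?_, fun f z hz => ?_, ?_⟩
      · rw [mul_apply_eq_comp, hP _ _ hz, hval _ _ _ _ hz, Fin.prod_univ_succ]
        ring
      · rw [mul_apply_eq_comp, hQ _ _ hz, hval _ _ _ _ hz, Fin.prod_univ_succ]
        ring
      · have h1 := finiteDimensional_ker_star_shift_sub (starRingEnd ℂ (a 0))
        have h2 : star (P * ((1 : ℂ) • HardyDisc.shift + (-a 0) • 1)) =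
            (star HardyDisc.shift - starRingEnd ℂ (a 0) • 1) * star P := by
          rw [star_mul]
          simp [sub_eq_add_neg]
        rw [h2]
        -- The kernel of a composition is the preimage of a finite-dimensional kernel under a map
        -- whose own kernel is finite-dimensional.
        exact inferInstanceAs (FiniteDimensional ℂ (Submodule.comap (star P).toLinearMap
          (star HardyDisc.shift - starRingEnd ℂ (a 0) • 1 : HardyDisc →L[ℂ] HardyDisc).ker))
  obtain ⟨P, Q, hP, hQ, hfd⟩ := key d a fun j => starRingEnd ℂ (a j)
  refine Submodule.finiteDimensional_of_le (S₂ := (star P).ker) fun f hf => ?_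
  refine LinearMap.mem_ker.2 (ext_inner_left ℂ fun h => ?_)
  rw [inner_zero_right, ContinuousLinearMap.coe_coe, ContinuousLinearMap.star_eq_adjoint,
    ContinuousLinearMap.adjoint_inner_right]
  refine hf _ ⟨c⁻¹ • Q h, trivial, fun z hz => ?_⟩
  have hc0 : c ≠ 0 := fun h => by simp [h] at hc
  have hne : ∏ j, (1 - starRingEnd ℂ (a j) * z) ≠ 0 := by
    refine Finset.prod_ne_zero_iff.2 fun j _ h => ?_
    have h1 : ‖starRingEnd ℂ (a j) * z‖ = 1 := by rw [← sub_eq_zero.1 h, norm_one]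
    rw [norm_mul, RCLike.norm_conj] at h1
    nlinarith [norm_nonneg (a j), norm_nonneg z, ha j]
  rw [hP _ _ hz, hφ z hz, HardyDisc.val_smul, hQ _ _ hz, Finset.prod_div_distrib]
  generalize ∏ j, (1 - starRingEnd ℂ (a j) * z) = D at hne ⊢
  field_simp

/-! ### Tensor products of subspaces -/

section Tensor

variable {n : ℕ}

/-- The elementary tensor as a multilinear map. -/
def hardyTensorMultilinear (n : ℕ) : MultilinearMap ℂ (fun _ : Fin n => HardyDisc) (Hardy n) where
  toFun := hardyTensor
  map_update_add' := by
    intro _ f i x y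
    ext k
    simp only [hardyTensor_apply, lp.coeFn_add, Pi.add_apply]
    rw [← Finset.mul_prod_erase _ _ (Finset.mem_univ i),
      ← Finset.mul_prod_erase _ _ (Finset.mem_univ i),
      ← Finset.mul_prod_erase _ _ (Finset.mem_univ i)]
    have h : ∀ w, ∏ j ∈ Finset.univ.erase i, (Function.update f i w) j (k j) =
        ∏ j ∈ Finset.univ.erase i, f j (k j) := fun w => Finset.prod_congr rfl fun j hj => by
      rw [Function.update_of_ne (Finset.ne_of_mem_erase hj)]
    simp only [h, Function.update_self, lp.coeFn_add, Pi.add_apply, add_mul]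
  map_update_smul' := by
    intro _ f i c x
    ext k
    simp only [hardyTensor_apply, lp.coeFn_smul, Pi.smul_apply, smul_eq_mul]
    rw [← Finset.mul_prod_erase _ _ (Finset.mem_univ i),
      ← Finset.mul_prod_erase _ _ (Finset.mem_univ i)]
    have h : ∀ w, ∏ j ∈ Finset.univ.erase i, (Function.update f i w) j (k j) =
        ∏ j ∈ Finset.univ.erase i, f j (k j) := fun w => Finset.prod_congr rfl fun j hj => by
      rw [Function.update_of_ne (Finset.ne_of_mem_erase hj)]
    simp only [h, Function.update_self, lp.coeFn_smul, Pi.smul_apply, smul_eq_mul, mul_assoc]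

theorem hardyTensor_mem_tensorSubspace {A : Fin n → Submodule ℂ HardyDisc} {f : Fin n → HardyDisc}
    (hf : ∀ i, f i ∈ A i) : hardyTensor f ∈ tensorSubspace A :=
  Submodule.le_topologicalClosure _ (Submodule.subset_span ⟨f, hf, rfl⟩)

theorem isClosed_tensorSubspace (A : Fin n → Submodule ℂ HardyDisc) :
    IsClosed (tensorSubspace A : Set (Hardy n)) :=
  Submodule.isClosed_topologicalClosure _

theorem tensorSubspace_le {A : Fin n → Submodule ℂ HardyDisc} {N : Submodule ℂ (Hardy n)}
    (hN : IsClosed (N : Set (Hardy n)))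
    (h : ∀ f : Fin n → HardyDisc, (∀ i, f i ∈ A i) → hardyTensor f ∈ N) : tensorSubspace A ≤ N :=
  Submodule.topologicalClosure_minimal _ (Submodule.span_le.2 (by
    rintro _ ⟨f, hf, rfl⟩
    exact h f hf)) hN

theorem mem_tensorSubspace_orthogonal {A : Fin n → Submodule ℂ HardyDisc} {g : Hardy n} :
    g ∈ (tensorSubspace A)ᗮ ↔
      ∀ f : Fin n → HardyDisc, (∀ i, f i ∈ A i) → (inner ℂ (hardyTensor f) g : ℂ) = 0 := by
  refine ⟨fun h f hf => h _ (hardyTensor_mem_tensorSubspace hf), fun h => ?_⟩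
  have h1 : tensorSubspace A ≤ (Submodule.span ℂ {g})ᗮ :=
    tensorSubspace_le (Submodule.isClosed_orthogonal _) fun f hf => by
      rw [Submodule.mem_orthogonal_singleton_iff_inner_left]
      exact h f hf
  intro x hx
  exact Submodule.mem_orthogonal_singleton_iff_inner_left.1 (h1 hx)

theorem tensorSubspace_isOrtho {A B : Fin n → Submodule ℂ HardyDisc} {i : Fin n} (h : A i ⟂ B i) :
    tensorSubspace A ⟂ tensorSubspace B := by
  refine tensorSubspace_le (Submodule.isClosed_orthogonal _) fun f hf => ?_
  rw [mem_tensorSubspace_orthogonal]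
  intro g hg
  rw [inner_hardyTensor]
  exact Finset.prod_eq_zero (Finset.mem_univ i)
    (Submodule.isOrtho_iff_inner_eq.1 h.symm _ (hg i) _ (hf i))

/-- The algebraic tensor product has finite-dimensional image, which is already closed; taking the
closure adds nothing. -/
theorem finiteDimensional_tensorSubspace {A : Fin n → Submodule ℂ HardyDisc}
    (hA : ∀ i, FiniteDimensional ℂ (A i)) : FiniteDimensional ℂ (tensorSubspace A) := by
  let t : MultilinearMap ℂ (fun i => A i) (Hardy n) :=
    (hardyTensorMultilinear n).compLinearMap fun i => (A i).subtype
  let r := (PiTensorProduct.lift t).range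
  have hr : FiniteDimensional ℂ r := inferInstance
  refine Submodule.finiteDimensional_of_le (S₂ := r)
    (tensorSubspace_le (Submodule.closed_of_finiteDimensional r) fun f hf => ?_)
  exact ⟨PiTensorProduct.tprod ℂ fun i => ⟨f i, hf i⟩, by rw [PiTensorProduct.lift.tprod]; rfl⟩

theorem star_coordMul_hardyTensor (i : Fin n) (f : Fin n → HardyDisc) :
    star (coordMul n i) (hardyTensor f) =
      hardyTensor (Function.update f i (star HardyDisc.shift (f i))) := by
  ext k
  rw [star_coordMul_apply, hardyTensor_apply, hardyTensor_apply]
  refine Finset.prod_congr rfl fun j _ => ?_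
  by_cases hj : j = i
  · subst hj
    rw [Function.update_self, HardyDisc.star_shift_apply, Pi.add_apply, Pi.single_eq_same]
  · rw [Function.update_of_ne hj, Pi.add_apply, Pi.single_eq_of_ne hj, add_zero]

/-- By duality: `M_{z_i}^*` acts on an elementary tensor as the backward shift of its `i`-th factor,
and model spaces are stable under the backward shift. -/
theorem isInvariantSubspace_coDoublyCommuting (φ : Fin n → ℂ → ℂ) :
    IsInvariantSubspace (coDoublyCommuting φ) := by
  refine ⟨Submodule.isClosed_orthogonal _, fun i f hf => ?_⟩
  rw [coDoublyCommuting, mem_tensorSubspace_orthogonal] at hf ⊢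
  intro g hg
  rw [← ContinuousLinearMap.adjoint_inner_left, ← ContinuousLinearMap.star_eq_adjoint,
    star_coordMul_hardyTensor]
  refine hf _ fun j => ?_
  by_cases hj : j = i
  · subst hj
    rw [Function.update_self]
    exact star_shift_mem_modelSpace (hg j)
  · rw [Function.update_of_ne hj]
    exact hg j

theorem finiteDimensional_coDoublyCommuting_orthogonal {φ : Fin n → ℂ → ℂ}
    (hφ : ∀ i, IsFiniteBlaschke (φ i)) : FiniteDimensional ℂ (coDoublyCommuting φ)ᗮ := by
  have h := finiteDimensional_tensorSubspace fun i => (hφ i).finiteDimensional_modelSpace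
  rw [coDoublyCommuting, Submodule.orthogonal_orthogonal]
  exact h

/-! ### Blaschke products of a coordinate -/

/-- Evaluation on the polydisc, as a linear map. -/
def evalPolydisc (n : ℕ) : Hardy n →ₗ[ℂ] ({z : Fin n → ℂ // ∀ i, ‖z i‖ < 1} → ℂ) where
  toFun f z := f.val z
  map_add' f g := funext fun z => by
    simp only [Hardy.val, Pi.add_apply, lp.coeFn_add, add_mul]
    exact (f.summable_val z.2).tsum_add (g.summable_val z.2)
  map_smul' c f := funext fun z => by
    simp only [Hardy.val, lp.coeFn_smul, Pi.smul_apply, smul_eq_mul, mul_assoc, RingHom.id_apply]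
    exact tsum_mul_left

theorem IsFiniteBlaschke.exists_operator {φ : ℂ → ℂ} (hφ : IsFiniteBlaschke φ) (i : Fin n) :
    ∃ B ∈ polydiscToeplitz n, star B * B = 1 ∧
      ∀ (f : Hardy n) (z : Fin n → ℂ), (∀ j, ‖z j‖ < 1) → (B f).val z = φ (z i) * f.val z := by
  obtain ⟨B, hB, hB1, hB2⟩ := exists_blaschke_operator (isClosed_polydiscToeplitz n)
    (coordMul_mem_polydiscToeplitz i) (star_coordMul_mul_self i) (evalPolydisc n) (fun z => z.1 i)
    (fun z => z.2 i) (fun f z => coordMul_val i f z.1) hφ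
  exact ⟨B, hB, hB1, fun f z hz => hB2 f ⟨z, hz⟩⟩

theorem isClosed_map_of_star_mul_self {B : Hardy n →L[ℂ] Hardy n} (hB : star B * B = 1)
    {N : Submodule ℂ (Hardy n)} (hN : IsClosed (N : Set (Hardy n))) :
    IsClosed (N.map (B : Hardy n →ₗ[ℂ] Hardy n) : Set (Hardy n)) := by
  -- The image of an isometry is cut out by `B B^* f = f`, so the image of `N` is an intersection of
  -- two closed conditions.
  have h : (N.map (B : Hardy n →ₗ[ℂ] Hardy n) : Set (Hardy n)) =
      {f | star B f ∈ (N : Set (Hardy n))} ∩ {f | B (star B f) = f} := by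
    have h1 : ∀ f, star B (B f) = f := fun f => congrArg (fun A : Hardy n →L[ℂ] Hardy n => A f) hB
    ext f
    constructor
    · rintro ⟨g, hg, rfl⟩
      refine ⟨?_, ?_⟩
      · change star B (B g) ∈ N
        rwa [h1]
      · change B (star B (B g)) = B g
        rw [h1]
    · rintro ⟨hf, hf'⟩
      exact ⟨_, hf, hf'⟩
  rw [h]
  exact (hN.preimage (star B).continuous).inter
    (isClosed_eq (B.continuous.comp (star B).continuous) continuous_id)

/-- A tensor product of coordinate subspaces with one factor multiplied by `φ` is the image of a
coordinate subspace under multiplication by `φ(z_i)`. -/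
theorem tensorSubspace_eq_map_coordSubspace {φ : ℂ → ℂ} (hφ : IsFiniteBlaschke φ) {i : Fin n}
    {B : Hardy n →L[ℂ] Hardy n} (hB : star B * B = 1)
    (hBval : ∀ (f : Hardy n) (z : Fin n → ℂ), (∀ j, ‖z j‖ < 1) →
      (B f).val z = φ (z i) * f.val z)
    {T : Fin n → Submodule ℂ HardyDisc} {Q : Submodule ℂ HardyDisc} (A : Fin n → Set ℕ)
    (hTi : T i = mulSubspace φ Q)
    (hQ : ∀ f ∈ Q, ∀ k ∉ A i, f k = 0) (hQ' : ∀ k ∈ A i, HardyDisc.monomial k ∈ Q)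
    (hT : ∀ j ≠ i, ∀ f ∈ T j, ∀ k ∉ A j, f k = 0)
    (hT' : ∀ j ≠ i, ∀ k ∈ A j, HardyDisc.monomial k ∈ T j) :
    tensorSubspace T =
      (coordSubspace {k | ∀ j, k j ∈ A j}).map (B : Hardy n →ₗ[ℂ] Hardy n) := by
  have hmul : ∀ (f : Fin n → HardyDisc) (q : HardyDisc),
      (∀ z : ℂ, ‖z‖ < 1 → (f i).val z = φ z * q.val z) →
      hardyTensor f = B (hardyTensor (Function.update f i q)) := by
    intro f q hq
    refine Hardy.val_inj fun z hz => ?_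
    rw [hBval _ z hz, hardyTensor_val _ hz, hardyTensor_val _ hz,
      ← Finset.mul_prod_erase _ _ (Finset.mem_univ i), hq _ (hz i),
      ← Finset.mul_prod_erase _ (fun j => (Function.update f i q j).val (z j)) (Finset.mem_univ i),
      Function.update_self, mul_assoc]
    congr 2
    refine Finset.prod_congr rfl fun j hj => ?_
    rw [Function.update_of_ne (Finset.ne_of_mem_erase hj)]
  refine le_antisymm ?_ ?_
  · refine tensorSubspace_le (isClosed_map_of_star_mul_self hB (isClosed_coordSubspace _)) ?_
    intro f hf
    obtain ⟨q, hq, hfq⟩ : f i ∈ mulSubspace φ Q := hTi ▸ hf i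
    refine ⟨_, ?_, (hmul f q hfq).symm⟩
    intro k hk
    obtain ⟨j, hj⟩ : ∃ j, k j ∉ A j := by
      by_contra! h
      exact hk h
    rw [hardyTensor_apply]
    refine Finset.prod_eq_zero (Finset.mem_univ j) ?_
    by_cases hji : j = i
    · subst hji
      rw [Function.update_self]
      exact hQ q hq _ hj
    · rw [Function.update_of_ne hji]
      exact hT j hji _ (hf j) _ hj
  · rw [Submodule.map_le_iff_le_comap]
    refine coordSubspace_le ((isClosed_tensorSubspace T).preimage B.continuous) fun k hk => ?_
    -- `g` is `φ z^{k_i}`, so that `B z^k` is the elementary tensor of monomials with `g` in slot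
    -- `i`.
    obtain ⟨g, hg⟩ := hφ.exists_mul (HardyDisc.monomial (k i))
    have h1 : B (Hardy.monomial k) =
        hardyTensor (Function.update (fun j => HardyDisc.monomial (k j)) i g) := by
      rw [hmul _ (HardyDisc.monomial (k i)) (by rwa [Function.update_self]), Function.update_idem]
      congr 1
      have h2 : Function.update (fun j => HardyDisc.monomial (k j)) i (HardyDisc.monomial (k i)) =
        fun j => HardyDisc.monomial (k j) := Function.update_eq_self i _
      rw [h2]
      ext l
      rw [Hardy.monomial_apply, hardyTensor_apply]
      simp only [HardyDisc.monomial_apply, Finset.prod_ite_zero, Finset.prod_const_one]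
      refine if_congr ?_ rfl rfl
      simp [funext_iff]
    change B (Hardy.monomial k) ∈ tensorSubspace T
    rw [h1]
    refine hardyTensor_mem_tensorSubspace fun j => ?_
    by_cases hji : j = i
    · subst hji
      rw [Function.update_self, hTi]
      exact ⟨_, hQ' _ (hk j), hg⟩
    · rw [Function.update_of_ne hji]
      exact hT' j hji _ (hk j)

end Tensor

/-! ### Coordinate projections -/

section Pieces

variable {n : ℕ}

theorem exists_coordProjection (A : Fin n → Set ℕ)
    (h : ∀ j, ∃ E ∈ polydiscToeplitz n, ∀ (f : Hardy n) (k : Fin n → ℕ),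
      (k j ∈ A j → E f k = f k) ∧ (k j ∉ A j → E f k = 0)) :
    ∃ E ∈ polydiscToeplitz n, ∀ (f : Hardy n) (k : Fin n → ℕ),
      ((∀ j, k j ∈ A j) → E f k = f k) ∧ ((¬ ∀ j, k j ∈ A j) → E f k = 0) := by
  classical
  have key : ∀ s : Finset (Fin n), ∃ E ∈ polydiscToeplitz n, ∀ (f : Hardy n) (k : Fin n → ℕ),
      ((∀ j ∈ s, k j ∈ A j) → E f k = f k) ∧ ((¬ ∀ j ∈ s, k j ∈ A j) → E f k = 0) := by
    intro s
    induction s using Finset.induction_on with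
    | empty => exact ⟨1, one_mem _, fun f k => ⟨fun _ => rfl, fun h => (h (by simp)).elim⟩⟩
    | insert i s _ ih =>
      obtain ⟨E, hE, hE'⟩ := ih
      obtain ⟨D, hD, hD'⟩ := h i
      refine ⟨D * E, mul_mem hD hE, fun f k => ⟨fun hk => ?_, fun hk => ?_⟩⟩
      · rw [mul_apply_eq_comp, (hD' _ k).1 (hk i (Finset.mem_insert_self i s)),
          (hE' f k).1 fun j hj => hk j (Finset.mem_insert_of_mem hj)]
      · rw [mul_apply_eq_comp]
        by_cases hki : k i ∈ A i
        · rw [(hD' _ k).1 hki, (hE' f k).2 fun hs => hk fun j hj => ?_]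
          rcases Finset.mem_insert.1 hj with rfl | hj
          · exact hki
          · exact hs j hj
        · exact (hD' _ k).2 hki
  obtain ⟨E, hE, hE'⟩ := key Finset.univ
  exact ⟨E, hE, by simpa using hE'⟩

theorem exists_coordProjection_lt (j : Fin n) (m : ℕ) :
    ∃ E ∈ polydiscToeplitz n, ∀ (f : Hardy n) (k : Fin n → ℕ),
      (k j ∈ {l | l < m} → E f k = f k) ∧ (k j ∉ {l | l < m} → E f k = 0) := by
  have hM := pow_mem (coordMul_mem_polydiscToeplitz j) m
  refine ⟨1 - coordMul n j ^ m * star (coordMul n j ^ m),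
    sub_mem (one_mem _) (mul_mem hM (star_mem hM)), fun f k => ?_⟩
  rw [_root_.sub_apply, one_apply_eq_self, lp.coeFn_sub, Pi.sub_apply, coordMul_pow_mul_star_apply,
    Set.mem_ofPred_eq]
  constructor <;> intro h
  · rw [if_pos h, sub_zero]
  · rw [if_neg h, sub_self]

theorem exists_coordProjection_ge (j : Fin n) (m : ℕ) :
    ∃ E ∈ polydiscToeplitz n, ∀ (f : Hardy n) (k : Fin n → ℕ),
      (k j ∈ {l | m ≤ l} → E f k = f k) ∧ (k j ∉ {l | m ≤ l} → E f k = 0) := by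
  have hM := pow_mem (coordMul_mem_polydiscToeplitz j) m
  refine ⟨coordMul n j ^ m * star (coordMul n j ^ m), mul_mem hM (star_mem hM), fun f k => ?_⟩
  rw [coordMul_pow_mul_star_apply, Set.mem_ofPred_eq]
  constructor <;> intro h
  · rw [if_neg (not_lt.2 h)]
  · rw [if_pos (not_le.1 h)]

/-- `E` is the projection onto the coordinate subspace and `B` is an isometry, so the projection
onto the image is `B E B^*`. -/
theorem starProjection_map_mem {B E : Hardy n →L[ℂ] Hardy n} (hB : B ∈ polydiscToeplitz n)
    (hB1 : star B * B = 1) (hE : E ∈ polydiscToeplitz n) (A : Set (Fin n → ℕ))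
    (hE' : ∀ (f : Hardy n) (k : Fin n → ℕ), (k ∈ A → E f k = f k) ∧ (k ∉ A → E f k = 0))
    {N : Submodule ℂ (Hardy n)} [CompleteSpace N]
    (hN : N = (coordSubspace A).map (B : Hardy n →ₗ[ℂ] Hardy n)) :
    N.starProjection ∈ polydiscToeplitz n := by
  have h1 : ∀ f, star B (B f) = f := fun f => congrArg (fun A : Hardy n →L[ℂ] Hardy n => A f) hB1
  have h : N.starProjection = B * E * star B := by
    ext1 f
    refine Submodule.eq_starProjection_of_mem_orthogonal ?_ ?_
    · rw [hN]
      exact ⟨E (star B f), fun k hk => (hE' _ k).2 hk, rfl⟩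
    · rw [hN]
      rintro _ ⟨c, hc, rfl⟩
      rw [ContinuousLinearMap.coe_coe, ← ContinuousLinearMap.adjoint_inner_right,
        ← ContinuousLinearMap.star_eq_adjoint, map_sub, mul_apply_eq_comp, mul_apply_eq_comp, h1,
        lp.inner_eq_tsum]
      refine (tsum_congr fun k => ?_).trans tsum_zero
      by_cases hk : k ∈ A
      · rw [lp.coeFn_sub, Pi.sub_apply, (hE' _ k).1 hk, sub_self, inner_zero_right]
      · rw [hc k hk, inner_zero_left]
  rw [h]
  exact mul_mem (mul_mem hB hE) (star_mem hB)

end Pieces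

/-! ### The unitary with prescribed pieces -/

theorem sub_starProjection_sub_mem {H : Type} [NormedAddCommGroup H] [InnerProductSpace ℂ H]
    {F M : Submodule ℂ H} [CompleteSpace F] [CompleteSpace M]
    (hFM : F ⟂ M) (f : H) :
    f - F.starProjection f - M.starProjection f ∈ (F ⊔ M)ᗮ := by
  rw [← Submodule.inf_orthogonal]
  refine ⟨sub_mem (F.sub_starProjection_mem_orthogonal f)
    (hFM.symm (M.starProjection_apply_mem f)), ?_⟩
  rw [sub_right_comm]
  exact sub_mem (M.sub_starProjection_mem_orthogonal f) (hFM (F.starProjection_apply_mem f))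

theorem sup_sup_orthogonal_eq {H : Type} [NormedAddCommGroup H] [InnerProductSpace ℂ H]
    {F M K : Submodule ℂ H} [CompleteSpace F] [CompleteSpace M]
    (hFM : F ⟂ M) (hF : F ≤ K) (hM : M ≤ K) : F ⊔ M ⊔ K ⊓ (F ⊔ M)ᗮ = K := by
  refine le_antisymm (sup_le (sup_le hF hM) inf_le_left) fun f hf => ?_
  have h : f = (F.starProjection f + M.starProjection f) +
      (f - F.starProjection f - M.starProjection f) := by abel
  have hFf := F.starProjection_apply_mem f
  have hMf := M.starProjection_apply_mem f
  rw [h]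
  exact add_mem (Submodule.mem_sup_left (Submodule.add_mem_sup hFf hMf))
    (Submodule.mem_sup_right ⟨sub_mem (sub_mem hf (hF hFf)) (hM hMf),
      sub_starProjection_sub_mem hFM f⟩)

theorem norm_sq_add_add {H : Type} [NormedAddCommGroup H] [InnerProductSpace ℂ H]
    {x y z : H} (hxy : inner ℂ x y = 0) (hxz : inner ℂ x z = 0)
    (hyz : inner ℂ y z = 0) :
    ‖x + y + z‖ * ‖x + y + z‖ = ‖x‖ * ‖x‖ + ‖y‖ * ‖y‖ + ‖z‖ * ‖z‖ := by
  rw [norm_add_sq_eq_norm_sq_add_norm_sq_of_inner_eq_zero (𝕜 := ℂ) _ _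
      (by rw [inner_add_left, hxz, hyz, add_zero]),
    norm_add_sq_eq_norm_sq_add_norm_sq_of_inner_eq_zero (𝕜 := ℂ) _ _ hxy]

section Glue

variable {H : Type} [NormedAddCommGroup H] [InnerProductSpace ℂ H] [CompleteSpace H]

/-- Given `K = F ⊕ M ⊕ L ≤ S`, an isometry `N` carrying `F ⊕ M` onto `M` and a unitary `V` from `F`
onto `S ⊖ K`, the map `V ⊕ N^* ⊕ I` is a unitary from `K` onto `S`. -/
theorem exists_glued_unitary {F M K S : Submodule ℂ H} [CompleteSpace F] [CompleteSpace M]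
    [CompleteSpace K] (hFM : F ⟂ M) (hF : F ≤ K) (hM : M ≤ K) (hK : K ≤ S)
    {N : H →L[ℂ] H} (hN : star N * N = 1) (hNF : ∀ f ∈ F ⊔ M, N f ∈ M)
    (hNM : ∀ f ∈ M, star N f ∈ F ⊔ M ∧ N (star N f) = f)
    (V : F ≃ₗᵢ[ℂ] (S ⊓ Kᗮ : Submodule ℂ H)) :
    ∃ U : K ≃ₗᵢ[ℂ] S, ∀ f : K, (U f : H) = V (F.orthogonalProjectionOnto f) +
      star N (M.starProjection f) + (f - F.starProjection f - M.starProjection f) := by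
  have hsup : F ⊔ M ≤ K := sup_le hF hM
  have hN1 : ∀ f, star N (N f) = f := fun f => congrArg (fun A : H →L[ℂ] H => A f) hN
  let T : H →L[ℂ] H := (S ⊓ Kᗮ).subtypeL ∘L (V : F →L[ℂ] (S ⊓ Kᗮ : Submodule ℂ H)) ∘L
    F.orthogonalProjectionOnto + star N ∘L M.starProjection +
      (ContinuousLinearMap.id ℂ H - F.starProjection - M.starProjection)
  have hT : ∀ f, T f = V (F.orthogonalProjectionOnto f) +
      star N (M.starProjection f) + (f - F.starProjection f - M.starProjection f) := fun _ => rfl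
  have hL : ∀ f ∈ K, f - F.starProjection f - M.starProjection f ∈ K := fun f hf =>
    sub_mem (sub_mem hf (hF (F.starProjection_apply_mem f))) (hM (M.starProjection_apply_mem f))
  have hTS : ∀ f : K, T f ∈ S := fun f => by
    rw [hT]
    exact add_mem (add_mem (V _).2.1 (hK (hsup (hNM _ (M.starProjection_apply_mem _)).1)))
      (hK (hL f f.2))
  have hnorm : ∀ f ∈ K, ‖T f‖ = ‖f‖ := by
    intro f hf
    have hl := sub_starProjection_sub_mem hFM f
    have h1 := hsup (hNM _ (M.starProjection_apply_mem f)).1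
    -- The three summands of `T f` lie in `Kᗮ`, in `F ⊔ M` and in `K ⊓ (F ⊔ M)ᗮ`, hence are mutually
    -- orthogonal, as are the three components of `f`; the norms agree term by term.
    have e1 : ‖T f‖ * ‖T f‖ = _ := norm_sq_add_add
      (Submodule.inner_left_of_mem_orthogonal h1 (V (F.orthogonalProjectionOnto f)).2.2)
      (Submodule.inner_left_of_mem_orthogonal (hL f hf) (V (F.orthogonalProjectionOnto f)).2.2)
      (Submodule.inner_right_of_mem_orthogonal (hNM _ (M.starProjection_apply_mem f)).1 hl)
    have e2 := norm_sq_add_add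
      (Submodule.isOrtho_iff_inner_eq.1 hFM _ (F.starProjection_apply_mem f) _
        (M.starProjection_apply_mem f))
      (Submodule.inner_right_of_mem_orthogonal
        (Submodule.mem_sup_left (F.starProjection_apply_mem f)) hl)
      (Submodule.inner_right_of_mem_orthogonal
        (Submodule.mem_sup_right (M.starProjection_apply_mem f)) hl)
    have e3 : F.starProjection f + M.starProjection f +
      (f - F.starProjection f - M.starProjection f) = f := by abel
    -- An adjoint of an isometry is only contractive in general; it preserves norms on `M` because
    -- `N (star N f) = f` there.
    have e4 : ‖star N (M.starProjection f)‖ = ‖M.starProjection f‖ := by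
      have h2 : ∀ x, ‖N x‖ = ‖x‖ := by
        intro x
        have : inner ℂ (N x) (N x) = (inner ℂ x x : ℂ) := by
          rw [← ContinuousLinearMap.adjoint_inner_right, ← ContinuousLinearMap.star_eq_adjoint, hN1]
        rw [@norm_eq_sqrt_re_inner ℂ, this, ← @norm_eq_sqrt_re_inner ℂ]
      rw [← h2, (hNM _ (M.starProjection_apply_mem f)).2]
    have e5 : ‖((V (F.orthogonalProjectionOnto f) : (S ⊓ Kᗮ : Submodule ℂ H)) : H)‖ =
        ‖F.starProjection f‖ := V.norm_map _
    rw [e3, ← e4, ← e5] at e2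
    exact (mul_self_inj (norm_nonneg _) (norm_nonneg _)).1 (e1.trans e2.symm)
  let U₀ : K →ₗᵢ[ℂ] S :=
    { toLinearMap := ((T : H →ₗ[ℂ] H) ∘ₗ K.subtype).codRestrict S hTS
      norm_map' := fun f => hnorm f f.2 }
  have hsurj : Function.Surjective U₀ := by
    intro g
    set y := K.starProjection (g : H) with hy
    have hyK : y ∈ K := K.starProjection_apply_mem _
    have hd : (g : H) - y ∈ S ⊓ Kᗮ :=
      ⟨sub_mem g.2 (hK hyK), K.sub_starProjection_mem_orthogonal _⟩
    set v := V.symm ⟨g - y, hd⟩ with hv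
    set y' := F.starProjection y + M.starProjection y with hy'
    have hy'm : y' ∈ F ⊔ M :=
      Submodule.add_mem_sup (F.starProjection_apply_mem y) (M.starProjection_apply_mem y)
    have hl : y - y' ∈ (F ⊔ M)ᗮ := by
      rw [hy', ← sub_sub]
      exact sub_starProjection_sub_mem hFM y
    have hl' := hl
    -- The preimage `x` of `g` undoes each block: `v` produces the part of `g` outside `K`, `N y'`
    -- produces its part `y'` in `F ⊔ M`, and `y - y'` is left fixed.
    rw [← Submodule.inf_orthogonal] at hl'
    have hNy := hNF y' hy'm
    set x := (v : H) + N y' + (y - y') with hx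
    have hxK : x ∈ K := add_mem (add_mem (hF v.2) (hM hNy)) (sub_mem hyK (hsup hy'm))
    have hPF : F.starProjection x = v := by
      rw [hx, map_add, map_add, Submodule.starProjection_eq_self_iff.2 v.2,
        (Submodule.starProjection_apply_eq_zero_iff _).2 (hFM.symm hNy),
        (Submodule.starProjection_apply_eq_zero_iff _).2 hl'.1, add_zero, add_zero]
    have hPM : M.starProjection x = N y' := by
      rw [hx, map_add, map_add, Submodule.starProjection_eq_self_iff.2 hNy,
        (Submodule.starProjection_apply_eq_zero_iff _).2 (hFM v.2),
        (Submodule.starProjection_apply_eq_zero_iff _).2 hl'.2, add_zero, zero_add]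
    refine ⟨⟨x, hxK⟩, Subtype.ext ?_⟩
    change T x = g
    have hPF' : F.orthogonalProjectionOnto x = v := Subtype.ext hPF
    rw [hT, hPF', hPF, hPM, hN1, hv, LinearIsometryEquiv.apply_symm_apply, ← hv, hx]
    generalize N y' = w, (v : H) = v'
    change (g : H) - y + y' + (v' + w + (y - y') - v' - w) = g
    generalize (g : H) = g'
    abel
  exact ⟨LinearIsometryEquiv.ofSurjective U₀ hsurj, fun f => rfl⟩

end Glue

/-! ### The pieces of `S_Φ` -/

section PieceCoordinates

variable {n : ℕ}

/-- Exponents of the functions whose multiples by `φ₁` form `F₁`. -/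
def exponentsF (m : ℕ) (j : Fin n) : Set ℕ := if (j : ℕ) = 0 then {l | l < m} else {l | l < 1}

/-- Exponents of the functions whose multiples by `φ₁` form `M₁`. -/
def exponentsM (m : ℕ) (j : Fin n) : Set ℕ :=
  if (j : ℕ) = 0 then {l | l < m} else if (j : ℕ) + 1 = n then {l | 1 ≤ l} else {l | l < 1}

theorem apply_of_mem_modelSpace_pow {m : ℕ} {f : HardyDisc} (hf : f ∈ modelSpace fun z => z ^ m)
    {k : ℕ} (hk : k ∉ {l | l < m}) : f k = 0 :=
  mem_modelSpace_pow.1 hf k (not_lt.1 hk)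

theorem monomial_mem_modelSpace_pow {m k : ℕ} (hk : k < m) :
    HardyDisc.monomial k ∈ modelSpace fun z => z ^ m :=
  mem_modelSpace_pow.2 fun l hl => by rw [HardyDisc.monomial_apply, if_neg (by omega)]

variable {φ : Fin n → ℂ → ℂ} {B : Hardy n →L[ℂ] Hardy n} {m : ℕ}

theorem pieceF_eq_map (hφ : ∀ i, IsFiniteBlaschke (φ i)) (hn : 0 < n) (hB : star B * B = 1)
    (hBval : ∀ (f : Hardy n) (z : Fin n → ℂ), (∀ j, ‖z j‖ < 1) →
      (B f).val z = φ ⟨0, hn⟩ (z ⟨0, hn⟩) * f.val z) :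
    pieceF φ m = (coordSubspace {k | ∀ j, k j ∈ exponentsF m j}).map
      (B : Hardy n →ₗ[ℂ] Hardy n) := by
  refine tensorSubspace_eq_map_coordSubspace (hφ _) hB hBval _ (if_pos rfl)
    (fun f hf k hk => apply_of_mem_modelSpace_pow hf hk)
    (fun k hk => monomial_mem_modelSpace_pow hk) (fun j hj f hf k hk => ?_) (fun j hj k hk => ?_)
  all_goals
    have hj0 : (j : ℕ) ≠ 0 := fun h => hj (Fin.ext h)
    simp only [exponentsF, if_neg hj0, Set.mem_ofPred_eq] at hk
    simp only [if_neg hj0] at *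
  · exact apply_of_mem_hardyConst hf (by omega)
  · rw [Nat.lt_one_iff.1 hk]
    exact monomial_zero_mem_hardyConst

theorem pieceM_eq_map (hφ : ∀ i, IsFiniteBlaschke (φ i)) (hn : 0 < n) (hB : star B * B = 1)
    (hBval : ∀ (f : Hardy n) (z : Fin n → ℂ), (∀ j, ‖z j‖ < 1) →
      (B f).val z = φ ⟨0, hn⟩ (z ⟨0, hn⟩) * f.val z) :
    pieceM φ m = (coordSubspace {k | ∀ j, k j ∈ exponentsM m j}).map
      (B : Hardy n →ₗ[ℂ] Hardy n) := by
  refine tensorSubspace_eq_map_coordSubspace (hφ _) hB hBval _ (if_pos rfl)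
    (fun f hf k hk => apply_of_mem_modelSpace_pow hf hk)
    (fun k hk => monomial_mem_modelSpace_pow hk) (fun j hj f hf k hk => ?_) (fun j hj k hk => ?_)
  all_goals
    have hj0 : (j : ℕ) ≠ 0 := fun h => hj (Fin.ext h)
    simp only [exponentsM, if_neg hj0] at hk
    simp only [if_neg hj0] at *
    split_ifs at *
    all_goals rw [Set.mem_ofPred_eq] at hk
  · rw [Nat.lt_one_iff.1 (not_le.1 hk)]
    exact apply_zero_of_mem_beurling_id hf
  · exact apply_of_mem_hardyConst hf (by omega)
  · exact monomial_mem_beurling_id (by omega)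
  · rw [Nat.lt_one_iff.1 hk]
    exact monomial_zero_mem_hardyConst

theorem commute_coordMul_of_val {i : Fin n} {θ : ℂ → ℂ}
    (hBval : ∀ (f : Hardy n) (z : Fin n → ℂ), (∀ j, ‖z j‖ < 1) → (B f).val z = θ (z i) * f.val z)
    (j : Fin n) (f : Hardy n) : B (coordMul n j f) = coordMul n j (B f) :=
  Hardy.val_inj fun z hz => by
    rw [hBval _ z hz, coordMul_val, coordMul_val, hBval _ z hz]
    ring

theorem finrank_coordSubspace_exponentsF (hn : 0 < n) (m : ℕ) :
    FiniteDimensional ℂ (coordSubspace {k : Fin n → ℕ | ∀ j, k j ∈ exponentsF m j}) ∧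
    Module.finrank ℂ (coordSubspace {k : Fin n → ℕ | ∀ j, k j ∈ exponentsF m j}) = m := by
  let e : Fin m ≃ {k : Fin n → ℕ | ∀ j, k j ∈ exponentsF m j} :=
    { toFun := fun l => ⟨Pi.single ⟨0, hn⟩ l, fun j => by
        unfold exponentsF
        split_ifs with hj
        · obtain rfl : j = ⟨0, hn⟩ := Fin.ext hj
          rw [Pi.single_eq_same]
          exact l.2
        · rw [Pi.single_eq_of_ne fun h => hj (by rw [h])]
          exact Nat.one_pos⟩
      invFun := fun k => ⟨k.1 ⟨0, hn⟩, by simpa [exponentsF] using k.2 ⟨0, hn⟩⟩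
      left_inv := fun l => Fin.ext (by simp)
      right_inv := fun k => by
        refine Subtype.ext (funext fun j => ?_)
        by_cases hj : (j : ℕ) = 0
        · obtain rfl : j = ⟨0, hn⟩ := Fin.ext hj
          simp
        · have := k.2 j
          simp only [exponentsF, if_neg hj, Set.mem_ofPred_eq, Nat.lt_one_iff] at this
          rw [this]
          exact Pi.single_eq_of_ne (fun h => hj (by rw [h])) _ }
  have := Finite.of_equiv _ e
  have := Fintype.ofFinite {k : Fin n → ℕ | ∀ j, k j ∈ exponentsF m j}
  refine ⟨(coordSubspaceEquiv _).symm.finiteDimensional, ?_⟩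
  rw [(coordSubspaceEquiv _).finrank_eq, Module.finrank_fintype_fun_eq_card,
    ← Fintype.card_congr e, Fintype.card_fin]

theorem finrank_pieceF (hφ : ∀ i, IsFiniteBlaschke (φ i)) (hn : 0 < n) (m : ℕ) :
    FiniteDimensional ℂ (pieceF φ m) ∧ Module.finrank ℂ (pieceF φ m) = m := by
  obtain ⟨B, -, hB1, hBval⟩ := (hφ ⟨0, hn⟩).exists_operator ⟨0, hn⟩
  obtain ⟨h1, h2⟩ := finrank_coordSubspace_exponentsF hn m
  have hinj : Function.Injective (B : Hardy n →ₗ[ℂ] Hardy n) :=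
    Function.LeftInverse.injective (g := fun f => star B f)
      fun f => congrArg (fun A : Hardy n →L[ℂ] Hardy n => A f) hB1
  rw [pieceF_eq_map hφ hn hB1 hBval]
  exact ⟨inferInstance, (Submodule.equivMapOfInjective _ hinj _).finrank_eq.symm.trans h2⟩

/-- The exponent sets of `F₁` and `M₁` differ only in the last direction, `k_n = 0` against `k_n ≥
1`. Their union leaves `k_n` free, and raising `k_n` by one carries that union bijectively onto the
exponents of `M₁`. -/
theorem forall_mem_exponentsF_iff (hn : 2 ≤ n) (m : ℕ) (k : Fin n → ℕ) :
    (∀ j, k j ∈ exponentsF m j) ↔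
      (∀ j ≠ ⟨n - 1, by omega⟩, k j ∈ exponentsF m j) ∧ k ⟨n - 1, by omega⟩ = 0 := by
  have hl : k ⟨n - 1, by omega⟩ ∈
      exponentsF m (⟨n - 1, by omega⟩ : Fin n) ↔ k ⟨n - 1, by omega⟩ = 0 := by
    rw [exponentsF, if_neg (show n - 1 ≠ 0 by omega), Set.mem_ofPred_eq, Nat.lt_one_iff]
  rw [← hl]
  refine ⟨fun h => ⟨fun j _ => h j, h _⟩, fun h j => ?_⟩
  by_cases hj : j = ⟨n - 1, by omega⟩
  · rw [hj]
    exact h.2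
  · exact h.1 j hj

theorem forall_mem_exponentsM_iff (hn : 2 ≤ n) (m : ℕ) (k : Fin n → ℕ) :
    (∀ j, k j ∈ exponentsM m j) ↔
      (∀ j ≠ ⟨n - 1, by omega⟩, k j ∈ exponentsF m j) ∧ 1 ≤ k ⟨n - 1, by omega⟩ := by
  have hl : k ⟨n - 1, by omega⟩ ∈
      exponentsM m (⟨n - 1, by omega⟩ : Fin n) ↔ 1 ≤ k ⟨n - 1, by omega⟩ := by
    rw [exponentsM, if_neg (show n - 1 ≠ 0 by omega), if_pos (show n - 1 + 1 = n by omega),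
      Set.mem_ofPred_eq]
  have hj' : ∀ j : Fin n, j ≠ ⟨n - 1, by omega⟩ → (exponentsM m j : Set ℕ) = exponentsF m j := by
    intro j hj
    have : (j : ℕ) + 1 ≠ n := fun h => hj (Fin.ext (by simp; omega))
    rw [exponentsM, if_neg this, exponentsF]
  rw [← hl]
  refine ⟨fun h => ⟨fun j hj => hj' j hj ▸ h j, h _⟩, fun h j => ?_⟩
  by_cases hj : j = ⟨n - 1, by omega⟩
  · rw [hj]
    exact h.2
  · rw [hj' j hj]
    exact h.1 j hj

theorem forall_ne_add_single_iff (l : Fin n) (A : Fin n → Set ℕ) (k : Fin n → ℕ) :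
    (∀ j ≠ l, (k + Pi.single l 1 : Fin n → ℕ) j ∈ A j) ↔ ∀ j ≠ l, k j ∈ A j := by
  refine forall₂_congr fun j hj => ?_
  rw [Pi.add_apply, Pi.single_eq_of_ne hj, add_zero]

theorem coordSubspace_exponents_sup (hn : 2 ≤ n) (m : ℕ) :
    coordSubspace {k : Fin n → ℕ | ∀ j, k j ∈ exponentsF m j} ⊔
      coordSubspace {k | ∀ j, k j ∈ exponentsM m j} =
    coordSubspace {k | ∀ j ≠ ⟨n - 1, by omega⟩, k j ∈ exponentsF m j} := by
  refine le_antisymm (sup_le ?_ ?_) fun c hc => ?_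
  · exact fun c hc k hk => hc k fun h => hk ((forall_mem_exponentsF_iff hn m k).1 h).1
  · exact fun c hc k hk => hc k fun h => hk ((forall_mem_exponentsM_iff hn m k).1 h).1
  · obtain ⟨E, -, hE⟩ := exists_coordProjection_lt (⟨n - 1, by omega⟩ : Fin n) 1
    refine Submodule.mem_sup.2 ⟨E c, fun k hk => ?_, c - E c, fun k hk => ?_, by abel⟩
    · by_cases hl : k ⟨n - 1, by omega⟩ < 1
      · rw [(hE c k).1 hl]
        exact hc k fun h => hk ((forall_mem_exponentsF_iff hn m k).2 ⟨h, Nat.lt_one_iff.1 hl⟩)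
      · exact (hE c k).2 hl
    · rw [lp.coeFn_sub, Pi.sub_apply]
      by_cases hl : k ⟨n - 1, by omega⟩ < 1
      · rw [(hE c k).1 hl, sub_self]
      · rw [(hE c k).2 hl, sub_zero]
        exact hc k fun h => hk ((forall_mem_exponentsM_iff hn m k).2 ⟨h, not_lt.1 hl⟩)

theorem coordMul_mem_coordSubspace_exponentsM (hn : 2 ≤ n) {c : Hardy n}
    (hc : c ∈ coordSubspace {k : Fin n → ℕ | ∀ j ≠ ⟨n - 1, by omega⟩, k j ∈ exponentsF m j}) :
    coordMul n ⟨n - 1, by omega⟩ c ∈ coordSubspace {k | ∀ j, k j ∈ exponentsM m j} := by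
  intro k hk
  rw [coordMul_apply]
  split_ifs with hl
  · rfl
  · refine hc _ fun h => hk ((forall_mem_exponentsM_iff hn m k).2
      ⟨?_, Nat.one_le_iff_ne_zero.2 hl⟩)
    have h1 := (forall_ne_add_single_iff _ _ _).2 h
    rwa [sub_add_single (Nat.one_le_iff_ne_zero.2 hl)] at h1

theorem star_coordMul_of_mem_coordSubspace_exponentsM (hn : 2 ≤ n) {c : Hardy n}
    (hc : c ∈ coordSubspace {k : Fin n → ℕ | ∀ j, k j ∈ exponentsM m j}) :
    star (coordMul n ⟨n - 1, by omega⟩) c ∈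
        coordSubspace {k | ∀ j ≠ ⟨n - 1, by omega⟩, k j ∈ exponentsF m j} ∧
      coordMul n ⟨n - 1, by omega⟩ (star (coordMul n ⟨n - 1, by omega⟩) c) = c := by
  constructor
  · intro k hk
    rw [star_coordMul_apply]
    refine hc _ fun h => hk ?_
    exact (forall_ne_add_single_iff _ _ k).1 ((forall_mem_exponentsM_iff hn m _).1 h).1
  · ext k
    rw [coordMul_apply]
    split_ifs with hl
    · refine (hc k fun h => ?_).symm
      have := ((forall_mem_exponentsM_iff hn m _).1 h).2
      omega
    · rw [star_coordMul_apply, sub_add_single (Nat.one_le_iff_ne_zero.2 hl)]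

/-- These are the hypotheses of `exists_glued_unitary` for `N = M_{z_n}`. They hold for the
coordinate subspaces and are transported by `B`, which commutes with `M_{z_n}`. -/
theorem coordMul_pieces (hφ : ∀ i, IsFiniteBlaschke (φ i)) (hn : 2 ≤ n) (m : ℕ) :
    (∀ f ∈ pieceF φ m ⊔ pieceM φ m, coordMul n ⟨n - 1, by omega⟩ f ∈ pieceM φ m) ∧
    ∀ f ∈ pieceM φ m, star (coordMul n ⟨n - 1, by omega⟩) f ∈ pieceF φ m ⊔ pieceM φ m ∧
      coordMul n ⟨n - 1, by omega⟩ (star (coordMul n ⟨n - 1, by omega⟩) f) = f := by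
  have hn0 : 0 < n := by omega
  obtain ⟨B, -, hB1, hBval⟩ := (hφ ⟨0, hn0⟩).exists_operator ⟨0, hn0⟩
  have hcomm := commute_coordMul_of_val hBval
  have hN : ∀ i f, star (coordMul n i) (coordMul n i f) = f := fun i f =>
    congrArg (fun A : Hardy n →L[ℂ] Hardy n => A f) (star_coordMul_mul_self i)
  have hsup : pieceF φ m ⊔ pieceM φ m = (coordSubspace
      {k | ∀ j ≠ ⟨n - 1, by omega⟩, k j ∈ exponentsF m j}).map (B : Hardy n →ₗ[ℂ] Hardy n) := by
    rw [pieceF_eq_map hφ hn0 hB1 hBval, pieceM_eq_map hφ hn0 hB1 hBval, ← Submodule.map_sup,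
      coordSubspace_exponents_sup hn]
  rw [hsup, pieceM_eq_map hφ hn0 hB1 hBval]
  constructor
  · intro f hf
    obtain ⟨c, hc, rfl⟩ := Submodule.mem_map.1 hf
    exact Submodule.mem_map.2 ⟨_, coordMul_mem_coordSubspace_exponentsM hn hc, hcomm _ c⟩
  · intro f hf
    obtain ⟨c, hc, rfl⟩ := Submodule.mem_map.1 hf
    obtain ⟨h1, h2⟩ := star_coordMul_of_mem_coordSubspace_exponentsM hn hc
    rw [ContinuousLinearMap.coe_coe]
    generalize (⟨n - 1, by omega⟩ : Fin n) = l at h1 h2 ⊢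
    -- `B` passes through the adjoint here because `c` is in the range of `M_{z_n}`: rewrite `c` as
    -- `M_{z_n} M_{z_n}^* c`, commute, and cancel.
    have h3 : star (coordMul n l) (B c) = B (star (coordMul n l) c) := by
      conv_lhs => rw [← h2]
      rw [hcomm, hN]
    refine ⟨Submodule.mem_map.2 ⟨_, h1, h3.symm⟩, ?_⟩
    rw [h3, ← hcomm, h2]

/-- `M₁` is in general infinite-dimensional, so the finite rank results do not apply; its projection
is assembled from exponent cutoffs and `φ₁(M_{z_1})`, all in `𝒯`. -/
theorem starProjection_pieceM_mem (hφ : ∀ i, IsFiniteBlaschke (φ i)) (hn : 0 < n) (m : ℕ)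
    [CompleteSpace (pieceM φ m)] : (pieceM φ m).starProjection ∈ polydiscToeplitz n := by
  obtain ⟨B, hB, hB1, hBval⟩ := (hφ ⟨0, hn⟩).exists_operator ⟨0, hn⟩
  obtain ⟨E, hE, hE'⟩ := exists_coordProjection (n := n) (exponentsM m) fun j => by
    unfold exponentsM
    split_ifs
    · exact exists_coordProjection_lt j m
    · exact exists_coordProjection_ge j 1
    · exact exists_coordProjection_lt j 1
  exact starProjection_map_mem hB hB1 hE _ hE' (pieceM_eq_map hφ hn hB1 hBval)

theorem pieceF_le (hn : 0 < n) (m : ℕ) : pieceF φ m ≤ coDoublyCommuting φ := by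
  refine tensorSubspace_isOrtho (i := ⟨0, hn⟩) ?_
  rw [if_pos rfl]
  exact mulSubspace_isOrtho_modelSpace _ _

theorem pieceM_le (hn : 0 < n) (m : ℕ) : pieceM φ m ≤ coDoublyCommuting φ := by
  refine tensorSubspace_isOrtho (i := ⟨0, hn⟩) ?_
  rw [if_pos rfl]
  exact mulSubspace_isOrtho_modelSpace _ _

theorem pieceF_isOrtho_pieceM (hn : 2 ≤ n) (m : ℕ) : pieceF φ m ⟂ pieceM φ m := by
  refine tensorSubspace_isOrtho (i := ⟨n - 1, by omega⟩) ?_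
  -- For `n ≥ 2` the last slot is not the first, so there the factors are the constants and `z
  -- H²(𝔻)`, which are orthogonal.
  have h0 : ((⟨n - 1, by omega⟩ : Fin n) : ℕ) ≠ 0 := by simp; omega
  rw [if_neg h0, if_neg h0, if_pos (by simp; omega)]
  exact hardyConst_isOrtho_beurling_id

end PieceCoordinates

/-! ### The main theorem: assembling the unitary and its membership in `𝒯`. -/

theorem theorem5p8 (n : ℕ) (hn : 2 ≤ n)
    (φ : Fin n → ℂ → ℂ) (hφ : ∀ i, IsFiniteBlaschke (φ i))
    (S : Submodule ℂ (Hardy n)) [CompleteSpace S] (hS : IsInvariantSubspace S)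
    (hfin : FiniteDimensional ℂ (Hardy n ⧸ S)) (hle : coDoublyCommuting φ ≤ S)
    (m : ℕ) (hm : m = Module.finrank ℂ (S ⊓ (coDoublyCommuting φ)ᗮ : Submodule ℂ (Hardy n))) :
    UnitarilyEquivalentAlgebras S (coDoublyCommuting φ) ∧
    -- `S_Φ = F₁ ⊕ M₁ ⊕ L`, an orthogonal decomposition
    (pieceF φ m ≤ coDoublyCommuting φ ∧ pieceM φ m ≤ coDoublyCommuting φ ∧
      pieceF φ m ⟂ pieceM φ m ∧
      pieceF φ m ⊔ pieceM φ m ⊔ pieceL φ m = coDoublyCommuting φ) ∧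
    -- `F₁` and `S ⊖ S_Φ` are finite-dimensional, and unitaries between them exist
    FiniteDimensional ℂ (S ⊓ (coDoublyCommuting φ)ᗮ : Submodule ℂ (Hardy n)) ∧
    Nonempty (pieceF φ m ≃ₗᵢ[ℂ] (S ⊓ (coDoublyCommuting φ)ᗮ : Submodule ℂ (Hardy n))) ∧
    -- every such unitary `V` extends to the unitary `V ⊕ M_{z_n}^* ⊕ I_L`, which does the job
    ∀ V : pieceF φ m ≃ₗᵢ[ℂ] (S ⊓ (coDoublyCommuting φ)ᗮ : Submodule ℂ (Hardy n)),
      ∃ U : coDoublyCommuting φ ≃ₗᵢ[ℂ] S,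
        (∀ (f : coDoublyCommuting φ) (hf : (f : Hardy n) ∈ pieceF φ m),
          (U f : Hardy n) = V ⟨f, hf⟩) ∧
        (∀ f : coDoublyCommuting φ, (f : Hardy n) ∈ pieceM φ m →
          (U f : Hardy n) = ContinuousLinearMap.adjoint (coordMul n ⟨n - 1, by omega⟩) f) ∧
        (∀ f : coDoublyCommuting φ, (f : Hardy n) ∈ pieceL φ m → (U f : Hardy n) = f) ∧
        Intertwines U := by
  have hn0 : 0 < n := by omega
  have hQ := finiteDimensional_coDoublyCommuting_orthogonal hφ
  have hfinΦ : FiniteDimensional ℂ (Hardy n ⧸ coDoublyCommuting φ) :=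
    (Submodule.quotientEquivOfIsCompl _ _
      (coDoublyCommuting φ).isCompl_orthogonal).symm.finiteDimensional
  have hinvΦ := isInvariantSubspace_coDoublyCommuting φ
  have hD : FiniteDimensional ℂ (S ⊓ (coDoublyCommuting φ)ᗮ : Submodule ℂ (Hardy n)) :=
    Submodule.finiteDimensional_of_le inf_le_right
  obtain ⟨hFfd, hFrank⟩ := finrank_pieceF hφ hn0 m
  have hFc : CompleteSpace (pieceF φ m) := (isClosed_tensorSubspace _).completeSpace_coe
  have hMc : CompleteSpace (pieceM φ m) := (isClosed_tensorSubspace _).completeSpace_coe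
  have hF := pieceF_le (φ := φ) hn0 m
  have hM := pieceM_le (φ := φ) hn0 m
  have hFM := pieceF_isOrtho_pieceM (φ := φ) hn m
  obtain ⟨hN1, hN2⟩ := coordMul_pieces hφ hn m
  have main : ∀ V : pieceF φ m ≃ₗᵢ[ℂ] (S ⊓ (coDoublyCommuting φ)ᗮ : Submodule ℂ (Hardy n)),
      ∃ U : coDoublyCommuting φ ≃ₗᵢ[ℂ] S,
        (∀ f : coDoublyCommuting φ, (U f : Hardy n) = V ((pieceF φ m).orthogonalProjectionOnto f) +
          star (coordMul n ⟨n - 1, by omega⟩) ((pieceM φ m).starProjection f) +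
          (f - (pieceF φ m).starProjection f - (pieceM φ m).starProjection f)) ∧
        Intertwines U ∧ Intertwines U.symm := by
    intro V
    obtain ⟨U, hU⟩ := exists_glued_unitary hFM hF hM hle (star_coordMul_mul_self _) hN1 hN2 V
    refine ⟨U, hU, intertwines_of_mem hinvΦ hfinΦ hS hfin hn0 U ?_⟩
    let T : Hardy n →L[ℂ] Hardy n := (S ⊓ (coDoublyCommuting φ)ᗮ).subtypeL ∘L
      (V : pieceF φ m →L[ℂ] (S ⊓ (coDoublyCommuting φ)ᗮ : Submodule ℂ (Hardy n))) ∘L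
        (pieceF φ m).orthogonalProjectionOnto
    have hT : T ∈ polydiscToeplitz n := by
      refine mem_polydiscToeplitz_of_finiteDimensional_range hn0 T
        (Submodule.finiteDimensional_of_le (S₂ := S ⊓ (coDoublyCommuting φ)ᗮ) ?_)
      rintro _ ⟨f, rfl⟩
      exact (V _).2
    have hPM := starProjection_pieceM_mem hφ hn0 m
    have hPF := starProjection_mem_of_finiteDimensional hn0 (pieceF φ m)
    have hPΦ := starProjection_mem_of_orthogonal hn0 hQ
    -- The extension by zero of `U` in closed form. Since `F₁` and `M₁` lie in `S_Φ`, projecting to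
    -- `S_Φ` beforehand does not affect their projections.
    have hW : S.subtypeL ∘L (U : coDoublyCommuting φ →L[ℂ] S) ∘L
        (coDoublyCommuting φ).orthogonalProjectionOnto =
        T + star (coordMul n ⟨n - 1, by omega⟩) * (pieceM φ m).starProjection +
          ((coDoublyCommuting φ).starProjection - (pieceF φ m).starProjection -
            (pieceM φ m).starProjection) := by
      ext1 f
      refine (hU ((coDoublyCommuting φ).orthogonalProjectionOnto f)).trans ?_
      have e1 := Submodule.orthogonalProjectionOnto_starProjection_of_le hF f
      have e2 : (pieceF φ m).starProjection ((coDoublyCommuting φ).starProjection f) =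
          (pieceF φ m).starProjection f := congrArg Subtype.val e1
      have e3 : (pieceM φ m).starProjection ((coDoublyCommuting φ).starProjection f) =
          (pieceM φ m).starProjection f :=
        congrArg Subtype.val (Submodule.orthogonalProjectionOnto_starProjection_of_le hM f)
      rw [← Submodule.starProjection_apply, e1, e2, e3]
      rfl
    rw [hW]
    exact add_mem (add_mem hT (mul_mem (star_mem (coordMul_mem_polydiscToeplitz _)) hPM))
      (sub_mem (sub_mem hPΦ hPF) hPM)
  -- Both spaces have dimension `m`, so matching orthonormal bases gives a unitary.
  have hV : Nonempty (pieceF φ m ≃ₗᵢ[ℂ] (S ⊓ (coDoublyCommuting φ)ᗮ : Submodule ℂ (Hardy n))) :=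
    ⟨(stdOrthonormalBasis ℂ (pieceF φ m)).equiv (stdOrthonormalBasis ℂ _)
      (finCongr (hFrank.trans hm))⟩
  refine ⟨?_, ⟨hF, hM, hFM, sup_sup_orthogonal_eq hFM hF hM⟩, hD, hV, fun V => ?_⟩
  · obtain ⟨V⟩ := hV
    obtain ⟨U, -, -, hU⟩ := main V
    exact ⟨U.symm, hU⟩
  · obtain ⟨U, hU, hI, -⟩ := main V
    refine ⟨U, fun f hf => ?_, fun f hf => ?_, fun f hf => ?_, hI⟩
    · have h1 : (pieceF φ m).orthogonalProjectionOnto (f : Hardy n) = ⟨f, hf⟩ :=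
        Subtype.ext (Submodule.starProjection_eq_self_iff.2 hf)
      rw [hU, h1, Submodule.starProjection_eq_self_iff.2 hf,
        (Submodule.starProjection_apply_eq_zero_iff _).2 (hFM hf), map_zero, sub_self, sub_zero,
        add_zero, add_zero]
    · have h1 : (pieceF φ m).orthogonalProjectionOnto (f : Hardy n) = 0 :=
        Submodule.orthogonalProjectionOnto_apply_of_mem_orthogonal (hFM.symm hf)
      rw [hU, h1, Submodule.starProjection_eq_self_iff.2 hf,
        (Submodule.starProjection_apply_eq_zero_iff _).2 (hFM.symm hf), map_zero, sub_zero,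
        sub_self, add_zero, Submodule.coe_zero, zero_add, ContinuousLinearMap.star_eq_adjoint]
    · have hf2 := hf.2
      rw [← Submodule.inf_orthogonal] at hf2
      have h1 : (pieceF φ m).orthogonalProjectionOnto (f : Hardy n) = 0 :=
        Submodule.orthogonalProjectionOnto_apply_of_mem_orthogonal hf2.1
      rw [hU, h1, (Submodule.starProjection_apply_eq_zero_iff _).2 hf2.1,
        (Submodule.starProjection_apply_eq_zero_iff _).2 hf2.2, map_zero, map_zero, sub_zero,
        sub_zero, Submodule.coe_zero, zero_add, zero_add]

end
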